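/- **Setting.** Let $X$ be a finite set, $f:2^X\to\mathbb{R}_{\ge 0}$ a nonnegative submodular function (optionally: nonnegative, monotone and submodular), ${\cal F}\subseteq 2^X$, and ${\cal G}$ a group of permutations of $X$. For ${\bf x}\in[0,1]^X$ let $F({\bf x})=\sum_{S\subseteq X} f(S)\prod_{i\in S}x_i\prod_{j\notin S}(1-x_j)$ be the multilinear extension of $f$, let $P({\cal F})=\mathrm{conv}\{{\bf 1}_S: S\in{\cal F}\}$, and let $\bar{\bf x}={\bf E}_{\sigma\in{\cal G}}[\sigma({\bf x})]$ be the average of ${\bf x}$ over the coordinate permutations $\sigma\in{\cal G}$. Assume that the instance $\max\{f(S):S\in{\cal F}\}$ is strongly symmetric with respect to ${\cal G}$: $f(\sigma(S))=f(S)$ for all $S\subseteq X$, $\sigma\in{\cal G}$, and $S\in{\cal F}\Leftrightarrow S'\in{\cal F}$ whenever $\overline{{\bf 1}_S}=\overline{{\bf 1}_{S'}}$. Let $OPT=\max\{F({\bf x}):{\bf x}\in P({\cal F})\}$, assume $OPT>0$ (in particular ${\cal F}\neq\emptyset$), and let $\overline{OPT}=\max\{F(\bar{\bf x}):{\bf x}\in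 P({\cal F})\}$. The symmetry gap is $\gamma=\overline{OPT}/OPT$. For $n\ge 1$ and $N=\{1,\dots,n\}$, the refinement $\tilde{\cal F}\subseteq 2^{N\times X}$ of ${\cal F}$ is the family of all $S\subseteq N\times X$ for which the vector $\big(\tfrac1n|S\cap(N\times\{j\})|\big)_{j\in X}$ lies in $P({\cal F})$. Let ${\cal C}_n$ be the class of instances $\max\{\tilde f(S):S\in\tilde{\cal F}\}$ where $\tilde f:2^{N\times X}\to\mathbb{R}_{\ge0}$ is an arbitrary nonnegative submodular function (nonnegative, monotone and submodular, under the monotone option). The multilinear relaxation of such an instance is $\max\{\tilde F({\bf x}):{\bf x}\in P(\tilde{\cal F})\}$, where $\tilde F$ is the multilinear extension of $\tilde f$. A randomized algorithm may use unlimited computation and the full knowledge of $\tilde{\cal F}$, but accesses $\tilde f$ only through (adaptive) value queries $S\mapsto\tilde f(S)$; it outputs a vector ${\bf x}$. It is an $\alpha$-approximation for ${\cal C}_n$ *in expectation* if on every instance of ${\cal C}_n$ almost surely ${\bf x}\in P(\tilde{\cal F})$, and ${\bf E}[\tilde F({\bf x})]\ge\alpha\max_{P(\tilde{\cal F})}\tilde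 F$; it is one *with success probability $p$* if on every instance of ${\cal C}_n$, with probability at least $p$, ${\bf x}\in P(\tilde{\cal F})$ and $\tilde F({\bf x})\ge\alpha\max_{P(\tilde{\cal F})}\tilde F$. **Theorem.** For every $\epsilon>0$, any (even randomized) $(1+\epsilon)\gamma$-approximation algorithm for the multilinear relaxation of the refined instances requires exponentially many value queries. Precisely: for every $\epsilon>0$ there is $c>0$ such that for every $p>0$ there is $n_0$ such that for all $n\ge n_0$, every randomized algorithm which is a $(1+\epsilon)\gamma$-approximation for the multilinear relaxation of the instances in ${\cal C}_n$, in expectation or with success probability $p$, asks on some instance of ${\cal C}_n$ at least $e^{c\,n|X|}$ value queries in expectation (hence also in the worst case). -/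

import Mathlib

open MeasureTheory

/-- The indicator vector `1_S ∈ {0,1}^U` of a set `S`. -/
def indVec {U : Type*} [DecidableEq U] (S : Finset U) : U → ℝ :=
  fun i => if i ∈ S then 1 else 0

/-- The polytope `P(F) = conv {1_S : S ∈ F}` of a family `F` of feasible sets. -/
def feasiblePolytope {U : Type*} [DecidableEq U] (F : Set (Finset U)) : Set (U → ℝ) :=
  convexHull ℝ (indVec '' F)

/-- The multilinear extension `F(x) = ∑_S f(S) ∏_{i ∈ S} x_i ∏_{j ∉ S} (1 - x_j)`. -/
def multilinearExt {U : Type*} [Fintype U] [DecidableEq U] (f : Finset U → ℝ) (x : U → ℝ) : ℝ :=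
  ∑ S : Finset U, f S * (∏ i ∈ S, x i) * ∏ j ∈ Sᶜ, (1 - x j)

/-- Submodularity of a set function. -/
def Submodular {U : Type*} [DecidableEq U] (f : Finset U → ℝ) : Prop :=
  ∀ S T : Finset U, f (S ∪ T) + f (S ∩ T) ≤ f S + f T

/-- The admissible objective functions: nonnegative submodular functions which are, if the
option `mono` is switched on, also monotone. With `mono = False` this is nonnegative submodular
maximization, with `mono = True` it is nonnegative monotone submodular maximization. -/
structure IsObjective {U : Type*} [DecidableEq U] (mono : Prop) (f : Finset U → ℝ) : Prop where
  nonneg : ∀ S, 0 ≤ f S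
  submodular : Submodular f
  monotone : mono → Monotone f

/-- The symmetrization `x̄ = E_{σ ∈ G} [σ(x)]`, where `σ(x)` has the coordinates of `x` permuted
by `σ`, so that `σ(1_S) = 1_{σ(S)}`. -/
noncomputable def symmetrize {X : Type*} [Fintype X] [DecidableEq X]
    (G : Subgroup (Equiv.Perm X)) (x : X → ℝ) : X → ℝ :=
  open Classical in
  fun j => (∑ σ : G, x ((σ : Equiv.Perm X).symm j)) / (Fintype.card G : ℝ)

/-- The instance `max {f(S) : S ∈ F}` is strongly symmetric with respect to `G`: the objective is
`G`-invariant, and membership in `F` depends only on the symmetrized indicator vector. -/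
structure StronglySymmetric {X : Type*} [Fintype X] [DecidableEq X]
    (f : Finset X → ℝ) (F : Set (Finset X)) (G : Subgroup (Equiv.Perm X)) : Prop where
  invariant : ∀ σ ∈ G, ∀ S : Finset X, f (S.map σ.toEmbedding) = f S
  feasible_iff : ∀ S T : Finset X,
    symmetrize G (indVec S) = symmetrize G (indVec T) → (S ∈ F ↔ T ∈ F)

/-- `OPT = max {F(x) : x ∈ P(F)}`, the optimum of the multilinear relaxation. -/
noncomputable def relaxOpt {U : Type*} [Fintype U] [DecidableEq U]
    (f : Finset U → ℝ) (F : Set (Finset U)) : ℝ :=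
  sSup (multilinearExt f '' feasiblePolytope F)

/-- `max {F(x̄) : x ∈ P(F)}`, the best value of a symmetrized solution. -/
noncomputable def symRelaxOpt {X : Type*} [Fintype X] [DecidableEq X]
    (f : Finset X → ℝ) (F : Set (Finset X)) (G : Subgroup (Equiv.Perm X)) : ℝ :=
  sSup ((fun x => multilinearExt f (symmetrize G x)) '' feasiblePolytope F)

/-- The symmetry gap of an instance. -/
noncomputable def symmetryGap {X : Type*} [Fintype X] [DecidableEq X]
    (f : Finset X → ℝ) (F : Set (Finset X)) (G : Subgroup (Equiv.Perm X)) : ℝ :=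
  symRelaxOpt f F G / relaxOpt f F

/-- The fractions `|S ∩ (N × {j})| / n` of the clusters `N × {j}`, `N = Fin n`, covered by `S`. -/
noncomputable def clusterFraction {X : Type*} [DecidableEq X] {n : ℕ}
    (S : Finset (Fin n × X)) : X → ℝ :=
  fun j => ((S.filter fun u => u.2 = j).card : ℝ) / (n : ℝ)

/-- The refinement of `F` on the ground set `N × X`, `N = Fin n`. -/
def refinement {X : Type*} [DecidableEq X] (n : ℕ) (F : Set (Finset X)) :
    Set (Finset (Fin n × X)) :=
  {S | clusterFraction S ∈ feasiblePolytope F}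

/-- A deterministic adaptive value-query algorithm over the ground set `U`, as a decision tree:
it either stops with an output, or queries the value of a set and continues depending on the
answer. Computation between queries is unrestricted. -/
inductive QueryTree (U : Type*) (Out : Type*) where
  | output (o : Out) : QueryTree U Out
  | query (S : Finset U) (next : ℝ → QueryTree U Out) : QueryTree U Out

/-- The output when the value oracle is `f`. -/
def QueryTree.run {U Out : Type*} (f : Finset U → ℝ) : QueryTree U Out → Out
  | .output o => o
  | .query S next => (next (f S)).run f

/-- The number of value queries asked when the value oracle is `f`. -/
def QueryTree.numQueries {U Out : Type*} (f : Finset U → ℝ) : QueryTree U Out → ℕ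
  | .output _ => 0
  | .query S next => (next (f S)).numQueries f + 1

/-- A randomized value-query algorithm with random seed in `Ω`, which outputs a vector in `ℝ^U`:
a decision tree for each seed, such that for each oracle the output and the number of queries are
random variables. -/
structure RandomizedAlg (U : Type*) (Ω : Type*) [MeasurableSpace Ω] where
  tree : Ω → QueryTree U (U → ℝ)
  measurable_run : ∀ f : Finset U → ℝ, Measurable fun ω => (tree ω).run f
  measurable_numQueries : ∀ f : Finset U → ℝ, Measurable fun ω => (tree ω).numQueries f

namespace RandomizedAlg

variable {U Ω : Type*} [Fintype U] [DecidableEq U] [MeasurableSpace Ω]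

/-- On the instance `(f, F)` the output is almost surely a feasible point of the multilinear
relaxation, and its expected value is at least `α` times the optimum of the relaxation. -/
def ApproxInExpectation (A : RandomizedAlg U Ω) (μ : Measure Ω) (α : ℝ)
    (f : Finset U → ℝ) (F : Set (Finset U)) : Prop :=
  (∀ᵐ ω ∂μ, (A.tree ω).run f ∈ feasiblePolytope F) ∧
    α * relaxOpt f F ≤ ∫ ω, multilinearExt f ((A.tree ω).run f) ∂μ

/-- On the instance `(f, F)`, with probability at least `p`, the output is a feasible point of the
multilinear relaxation whose value is at least `α` times the optimum of the relaxation. -/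
def ApproxWithProb (A : RandomizedAlg U Ω) (μ : Measure Ω) (α p : ℝ)
    (f : Finset U → ℝ) (F : Set (Finset U)) : Prop :=
  p ≤ μ.real {ω | (A.tree ω).run f ∈ feasiblePolytope F ∧
    α * relaxOpt f F ≤ multilinearExt f ((A.tree ω).run f)}

/-- The expected number of value queries on the objective `f`. -/
noncomputable def expectedQueries (A : RandomizedAlg U Ω) (μ : Measure Ω)
    (f : Finset U → ℝ) : ENNReal :=
  ∫⁻ ω, ((A.tree ω).numQueries f : ENNReal) ∂μ

end RandomizedAlg

/-! The algorithm cannot tell apart one oracle with optimum about `OPT * γ` and many oracles with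
optimum about `OPT`.

Suppose a function `Φ` on the cube is close to the multilinear extension of `f`, has diminishing
returns, and satisfies `Φ x = Φ x̄` whenever `x` is close to its symmetrization `x̄`. In each copy
`i` of `X`, hide a permutation `τ i ∈ G` and let `h τ S` be `Φ` of the fractions of the clusters
`{(i, τ i j)}`. Let `g S` be `Φ` of the symmetrized cluster fractions; these do not depend on `τ`.
All these oracles are admissible. For a fixed query `S` and random `τ`, the hidden fractions
concentrate around their symmetrization (`card_asymmetry_gt_le`), so `h τ S = g S` except with
exponentially small probability. Hence few queries give the same run on `g` and on most `h τ`
(`card_run_ne_le`). The output is a vector, not a set, so its multilinear value must also be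
transferred; this is a Markov argument (`card_multilinearExt_lt_le`). Every feasible point has
`g`-value at most about `OPT * γ`, because `Φ` composed with a substochastic linear map is concave
in each coordinate. Every `h τ` has optimum about `OPT`: a near-optimal point of `P(F)` is rounded
to `n` feasible sets, which are twisted by `τ`; strong symmetry keeps them feasible.

The analytic core is `exists_isDRFunction`. With `H x = F x - F x̄` and `D` the squared distance of
`x` from `x̄`, take `Φ = F - φ(D) H + κ * penalty`. Both Hessians in `(1 - φ) F + φ F(x̄)` have the
right sign. By invariance of `f` the gradient of `F` at a symmetric point is symmetric, so `H =
O(D)` and its derivative is `O(√D)`. If `φ` falls on a logarithmic scale, `tφ'` and `t²φ''` are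
uniformly small, and so are all terms containing derivatives of `φ`; a small symmetric concave
penalty absorbs them. -/

section MultilinearExtension

/-! ### Derivatives of the multilinear extension -/

variable {U : Type*}

/-- Moving the base point along the line shifts the parameter; thus every directional derivative
below needs to be computed at `s = 0` only. -/
theorem hasDerivAt_line {h : (U → ℝ) → ℝ} {h' : (U → ℝ) → ℝ} {v : U → ℝ}
    (hd : ∀ x, HasDerivAt (fun s : ℝ => h (x + s • v)) (h' x) 0) (x : U → ℝ) (t : ℝ) :
    HasDerivAt (fun s : ℝ => h (x + s • v)) (h' (x + t • v)) t := by
  have h1 : HasDerivAt (fun s : ℝ => h (x + t • v + s • v)) (h' (x + t • v)) (t - t) := by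
    simpa using hd (x + t • v)
  have h2 := h1.comp_sub_const t t
  refine h2.congr_of_eventuallyEq (Filter.Eventually.of_forall fun s => ?_)
  simp only
  congr 1
  rw [add_assoc, ← add_smul]
  congr 2
  ring

theorem segment_nonneg {x y : U → ℝ} (hx : 0 ≤ x) (hy : 0 ≤ y) {t : ℝ} (h0 : 0 ≤ t) (h1 : t ≤ 1) :
    0 ≤ x + t • (y - x) := by
  intro i
  have h2 := hx i
  have h3 := hy i
  simp only [Pi.zero_apply, Pi.add_apply, Pi.smul_apply, Pi.sub_apply, smul_eq_mul] at *
  nlinarith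

theorem segment_le_one {x y : U → ℝ} (hx : x ≤ 1) (hy : y ≤ 1) {t : ℝ} (h0 : 0 ≤ t) (h1 : t ≤ 1) :
    x + t • (y - x) ≤ 1 := by
  intro i
  have h2 := hx i
  have h3 := hy i
  simp only [Pi.one_apply, Pi.add_apply, Pi.smul_apply, Pi.sub_apply, smul_eq_mul] at *
  nlinarith

/-- A bound on a function along a segment of the cube by a bound of its directional derivative. -/
theorem abs_sub_le_of_hasDerivAt_segment {h h' : (U → ℝ) → ℝ} {x y : U → ℝ} {C : ℝ}
    (hd : ∀ z, HasDerivAt (fun s : ℝ => h (z + s • (y - x))) (h' z) 0)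
    (hC : ∀ t : ℝ, 0 ≤ t → t ≤ 1 → |h' (x + t • (y - x))| ≤ C) :
    |h y - h x| ≤ C := by
  have := norm_image_sub_le_of_norm_deriv_le_segment_01' (f := fun s : ℝ => h (x + s • (y - x)))
    (f' := fun t => h' (x + t • (y - x))) (C := C)
    (fun t _ => (hasDerivAt_line hd x t).hasDerivWithinAt)
    (fun t ht => hC t ht.1 ht.2.le)
  simpa using this

variable [DecidableEq U]

/-- The discrete partial derivative `S ↦ f (S ∪ {i}) - f (S \ {i})`. -/
def marginal (i : U) (f : Finset U → ℝ) (S : Finset U) : ℝ :=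
  f (insert i S) - f (S.erase i)

theorem abs_marginal_le {f : Finset U → ℝ} {M : ℝ} (h : ∀ S, |f S| ≤ M) (i : U) (S : Finset U) :
    |marginal i f S| ≤ 2 * M := by
  have h1 := abs_le.1 (h (insert i S))
  have h2 := abs_le.1 (h (S.erase i))
  unfold marginal
  rw [abs_le]
  constructor <;> linarith [h1.1, h1.2, h2.1, h2.2]

theorem marginal_nonneg {f : Finset U → ℝ} (h : Monotone f) (i : U) (S : Finset U) :
    0 ≤ marginal i f S :=
  sub_nonneg.2 (h ((Finset.erase_subset i S).trans (Finset.subset_insert i S)))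

/-- The discrete form of `∂²F/∂xᵢ∂xⱼ ≤ 0`. For `i ≠ j` it is submodularity for two sets that differ
exactly in `i` and `j`; for `i = j` it vanishes, since a marginal in `i` ignores whether `i ∈ S`. -/
theorem marginal_marginal_nonpos {f : Finset U → ℝ} (h : Submodular f) (i j : U) (S : Finset U) :
    marginal j (marginal i f) S ≤ 0 := by
  unfold marginal
  by_cases hij : i = j
  · subst hij
    have e : insert i (S.erase i) = insert i S := by grind
    simp [e]
  · have h1 := h (insert i ((insert j S).erase i)) (insert j ((insert i S).erase j))
    have h2 := h (insert i (S.erase j)) ((insert j S).erase i)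
    have e1 : insert i (S.erase j) ∪ (insert j S).erase i = insert i (insert j S) := by
      ext k; simp; grind
    have e2 : insert i (S.erase j) ∩ (insert j S).erase i = (S.erase j).erase i := by
      ext k; simp; grind
    rw [e1, e2] at h2
    linarith

variable [Fintype U]

theorem prod_mul_prod_compl_eq (S : Finset U) (x : U → ℝ) :
    (∏ i ∈ S, x i) * ∏ j ∈ Sᶜ, (1 - x j) = ∏ i, if i ∈ S then x i else 1 - x i := by
  rw [← Finset.prod_mul_prod_compl S]
  congr 1
  · exact Finset.prod_congr rfl fun i hi => by simp [hi]
  · exact Finset.prod_congr rfl fun i hi => by simp [Finset.mem_compl.1 hi]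

theorem multilinearExt_eq (f : Finset U → ℝ) (x : U → ℝ) :
    multilinearExt f x = ∑ S : Finset U, f S * ∏ i, if i ∈ S then x i else 1 - x i := by
  simp only [multilinearExt, mul_assoc, prod_mul_prod_compl_eq]

theorem sum_weights (x : U → ℝ) :
    ∑ S : Finset U, ∏ i, (if i ∈ S then x i else 1 - x i) = 1 := by
  have h := Fintype.prod_add x (fun i => 1 - x i)
  simp only [add_sub_cancel, Finset.prod_const_one] at h
  simpa only [prod_mul_prod_compl_eq] using h.symm

theorem weight_nonneg {x : U → ℝ} (h0 : 0 ≤ x) (h1 : x ≤ 1) (S : Finset U) :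
    0 ≤ ∏ i, (if i ∈ S then x i else 1 - x i) := by
  refine Finset.prod_nonneg fun i _ => ?_
  have := h0 i
  have := h1 i
  simp only [Pi.zero_apply, Pi.one_apply] at *
  split_ifs <;> linarith

theorem multilinearExt_mono {f g : Finset U → ℝ} {x : U → ℝ} (h0 : 0 ≤ x) (h1 : x ≤ 1)
    (h : ∀ S, f S ≤ g S) : multilinearExt f x ≤ multilinearExt g x := by
  rw [multilinearExt_eq, multilinearExt_eq]
  exact Finset.sum_le_sum fun S _ => mul_le_mul_of_nonneg_right (h S) (weight_nonneg h0 h1 S)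

theorem multilinearExt_const (c : ℝ) (x : U → ℝ) : multilinearExt (fun _ => c) x = c := by
  rw [multilinearExt_eq, ← Finset.mul_sum, sum_weights, mul_one]

theorem multilinearExt_nonneg {f : Finset U → ℝ} {x : U → ℝ} (h0 : 0 ≤ x) (h1 : x ≤ 1)
    (h : ∀ S, 0 ≤ f S) : 0 ≤ multilinearExt f x := by
  simpa [multilinearExt_const] using multilinearExt_mono (f := fun _ => 0) h0 h1 h

theorem multilinearExt_nonpos {f : Finset U → ℝ} {x : U → ℝ} (h0 : 0 ≤ x) (h1 : x ≤ 1)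
    (h : ∀ S, f S ≤ 0) : multilinearExt f x ≤ 0 := by
  simpa [multilinearExt_const] using multilinearExt_mono (g := fun _ => 0) h0 h1 h

theorem abs_multilinearExt_le {f : Finset U → ℝ} {x : U → ℝ} {M : ℝ} (h0 : 0 ≤ x) (h1 : x ≤ 1)
    (h : ∀ S, |f S| ≤ M) : |multilinearExt f x| ≤ M := by
  rw [abs_le]
  constructor
  · simpa [multilinearExt_const] using
      multilinearExt_mono (f := fun _ => -M) h0 h1 fun S => (abs_le.1 (h S)).1
  · simpa [multilinearExt_const] using
      multilinearExt_mono (g := fun _ => M) h0 h1 fun S => (abs_le.1 (h S)).2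

theorem multilinearExt_sub (f g : Finset U → ℝ) (x : U → ℝ) :
    multilinearExt (fun S => f S - g S) x = multilinearExt f x - multilinearExt g x := by
  simp only [multilinearExt_eq, sub_mul, Finset.sum_sub_distrib]

theorem multilinearExt_indVec (f : Finset U → ℝ) (T : Finset U) :
    multilinearExt f (indVec T) = f T := by
  rw [multilinearExt_eq, Finset.sum_eq_single T]
  · rw [Finset.prod_eq_one, mul_one]
    intro i _
    by_cases h : i ∈ T <;> simp [indVec, h]
  · intro S _ hST
    have : ∃ i, ¬ (i ∈ S ↔ i ∈ T) := by
      by_contra! h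
      exact hST (Finset.ext h)
    obtain ⟨i, hi⟩ := this
    rw [Finset.prod_eq_zero (Finset.mem_univ i), mul_zero]
    by_cases h : i ∈ T <;> by_cases h' : i ∈ S <;> simp [indVec, h, h'] at hi ⊢
  · simp

theorem continuous_multilinearExt (f : Finset U → ℝ) : Continuous (multilinearExt f) := by
  unfold multilinearExt
  fun_prop

/-- Identifies `∂F/∂xᵢ` with the multilinear extension of the marginal: differentiating a weight
deletes its `i`-th factor and leaves a sign, and the sets pair up as `S`, `S ∪ {i}`. -/
theorem multilinearExt_marginal (f : Finset U → ℝ) (x : U → ℝ) (i : U) :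
    multilinearExt (marginal i f) x = ∑ S : Finset U, f S *
      ((∏ j ∈ Finset.univ.erase i, if j ∈ S then x j else 1 - x j) *
        if i ∈ S then 1 else -1) := by
  have huniv : (Finset.univ : Finset (Finset U)) = (insert i (Finset.univ.erase i)).powerset := by
    simp
  have hi : i ∉ (Finset.univ : Finset U).erase i := by simp
  rw [multilinearExt_eq, huniv, Finset.sum_powerset_insert hi, Finset.sum_powerset_insert hi,
    ← Finset.sum_add_distrib, ← Finset.sum_add_distrib]
  refine Finset.sum_congr rfl fun S hS => ?_
  have hiS : i ∉ S := fun h => hi (Finset.mem_powerset.1 hS h)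
  have hprod : ∏ j ∈ Finset.univ.erase i, (if j ∈ insert i S then x j else 1 - x j) =
      ∏ j ∈ Finset.univ.erase i, (if j ∈ S then x j else 1 - x j) := by
    refine Finset.prod_congr rfl fun j hj => ?_
    simp [Finset.ne_of_mem_erase hj]
  rw [← Finset.mul_prod_erase _ _ (Finset.mem_univ i), ← Finset.mul_prod_erase _ _
    (Finset.mem_univ i), hprod]
  simp only [marginal, hiS, Finset.mem_insert_self, if_true, if_false, Finset.insert_idem,
    Finset.erase_eq_of_notMem hiS, Finset.erase_insert hiS]
  ring

/-- The derivative of the multilinear extension of `f` at `x` in direction `v`. -/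
noncomputable def dirDeriv (f : Finset U → ℝ) (v x : U → ℝ) : ℝ :=
  ∑ i, v i * multilinearExt (marginal i f) x

theorem hasDerivAt_multilinearExt (f : Finset U → ℝ) (x v : U → ℝ) :
    HasDerivAt (fun s : ℝ => multilinearExt f (x + s • v)) (dirDeriv f v x) 0 := by
  have hd : ∀ S : Finset U, HasDerivAt
      (fun s : ℝ => ∏ i, if i ∈ S then (x + s • v) i else 1 - (x + s • v) i)
      (∑ i, (∏ j ∈ Finset.univ.erase i, if j ∈ S then x j else 1 - x j) *
        ((if i ∈ S then 1 else -1) * v i)) 0 := by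
    intro S
    have h1 : ∀ i ∈ (Finset.univ : Finset U), HasDerivAt
        (fun s : ℝ => if i ∈ S then (x + s • v) i else 1 - (x + s • v) i)
        ((if i ∈ S then 1 else -1) * v i) 0 := by
      intro i _
      have hb : HasDerivAt (fun s : ℝ => (x + s • v) i) (v i) 0 := by
        simpa using ((hasDerivAt_id (0 : ℝ)).mul_const (v i)).const_add (x i)
      split_ifs
      · simpa using hb
      · simpa using hb.const_sub 1
    have h2 := HasDerivAt.fun_finsetProd h1
    simpa using h2
  have h := HasDerivAt.fun_sum fun (S : Finset U) (_ : S ∈ Finset.univ) => (hd S).const_mul (f S)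
  simp only [multilinearExt_eq]
  refine h.congr_deriv ?_
  simp only [dirDeriv, multilinearExt_marginal, Finset.mul_sum]
  rw [Finset.sum_comm]
  exact Finset.sum_congr rfl fun i _ => Finset.sum_congr rfl fun S _ => by ring

theorem abs_dirDeriv_le {f : Finset U → ℝ} {M : ℝ} (h : ∀ S, |f S| ≤ M) {x : U → ℝ} (h0 : 0 ≤ x)
    (h1 : x ≤ 1) (v : U → ℝ) : |dirDeriv f v x| ≤ 2 * M * ∑ i, |v i| := by
  unfold dirDeriv
  refine (Finset.abs_sum_le_sum_abs _ _).trans ?_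
  rw [Finset.mul_sum]
  refine Finset.sum_le_sum fun i _ => ?_
  rw [abs_mul, mul_comm]
  exact mul_le_mul_of_nonneg_right (abs_multilinearExt_le h0 h1 (abs_marginal_le h i))
    (abs_nonneg _)

theorem abs_multilinearExt_sub_le {f : Finset U → ℝ} {M : ℝ} (h : ∀ S, |f S| ≤ M) {x y : U → ℝ}
    (hx0 : 0 ≤ x) (hx1 : x ≤ 1) (hy0 : 0 ≤ y) (hy1 : y ≤ 1) :
    |multilinearExt f y - multilinearExt f x| ≤ 2 * M * ∑ i, |y i - x i| :=
  abs_sub_le_of_hasDerivAt_segment (h' := dirDeriv f (y - x))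
    (fun z => hasDerivAt_multilinearExt f z (y - x))
    fun _ h0 h1 => abs_dirDeriv_le h (segment_nonneg hx0 hy0 h0 h1) (segment_le_one hx1 hy1 h0 h1) _

/-- The second derivative of the multilinear extension of `f` at `x` in directions `v` and `w`. -/
noncomputable def dirDeriv₂ (f : Finset U → ℝ) (v w x : U → ℝ) : ℝ :=
  ∑ i, v i * dirDeriv (marginal i f) w x

theorem hasDerivAt_dirDeriv (f : Finset U → ℝ) (v x w : U → ℝ) :
    HasDerivAt (fun s : ℝ => dirDeriv f v (x + s • w)) (dirDeriv₂ f v w x) 0 :=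
  HasDerivAt.fun_sum fun i _ => (hasDerivAt_multilinearExt (marginal i f) x w).const_mul (v i)

theorem dirDeriv_nonneg {f : Finset U → ℝ} (h : Monotone f) {x v : U → ℝ} (h0 : 0 ≤ x)
    (h1 : x ≤ 1) (hv : 0 ≤ v) : 0 ≤ dirDeriv f v x :=
  Finset.sum_nonneg fun i _ => mul_nonneg (hv i) (multilinearExt_nonneg h0 h1 (marginal_nonneg h i))

/-- All second partial derivatives are nonpositive, so nonnegative directions give a sign; for
mixed-sign directions there is none. -/
theorem dirDeriv₂_nonpos {f : Finset U → ℝ} (h : Submodular f) {x v w : U → ℝ} (h0 : 0 ≤ x)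
    (h1 : x ≤ 1) (hv : 0 ≤ v) (hw : 0 ≤ w) : dirDeriv₂ f v w x ≤ 0 :=
  Finset.sum_nonpos fun i _ => mul_nonpos_of_nonneg_of_nonpos (hv i) <|
    Finset.sum_nonpos fun j _ => mul_nonpos_of_nonneg_of_nonpos (hw j) <|
      multilinearExt_nonpos h0 h1 (marginal_marginal_nonpos h i j)

theorem abs_dirDeriv_sub_le {f : Finset U → ℝ} {M : ℝ} (h : ∀ S, |f S| ≤ M) {x y : U → ℝ}
    (hx0 : 0 ≤ x) (hx1 : x ≤ 1) (hy0 : 0 ≤ y) (hy1 : y ≤ 1) (v : U → ℝ) :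
    |dirDeriv f v y - dirDeriv f v x| ≤ 4 * M * (∑ i, |y i - x i|) * ∑ i, |v i| := by
  unfold dirDeriv
  rw [← Finset.sum_sub_distrib, Finset.mul_sum]
  refine (Finset.abs_sum_le_sum_abs _ _).trans (Finset.sum_le_sum fun i _ => ?_)
  rw [← mul_sub, abs_mul, mul_comm]
  refine mul_le_mul_of_nonneg_right ?_ (abs_nonneg _)
  have := abs_multilinearExt_sub_le (abs_marginal_le h i) hx0 hx1 hy0 hy1
  linarith

theorem abs_multilinearExt_sub_sub_le {f : Finset U → ℝ} {M : ℝ} (h : ∀ S, |f S| ≤ M)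
    {x y : U → ℝ} (hx0 : 0 ≤ x) (hx1 : x ≤ 1) (hy0 : 0 ≤ y) (hy1 : y ≤ 1) :
    |multilinearExt f y - multilinearExt f x - dirDeriv f (y - x) x| ≤
      4 * M * (∑ i, |y i - x i|) ^ 2 := by
  have hM : 0 ≤ M := (abs_nonneg _).trans (h ∅)
  -- Mean value inequality after subtracting the linear Taylor term; what is left has as derivative
  -- the variation of the gradient along the segment.
  have key := norm_image_sub_le_of_norm_deriv_le_segment_01'
    (f := fun s : ℝ => multilinearExt f (x + s • (y - x)) - s * dirDeriv f (y - x) x)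
    (f' := fun t => dirDeriv f (y - x) (x + t • (y - x)) - 1 * dirDeriv f (y - x) x)
    (C := 4 * M * (∑ i, |y i - x i|) ^ 2)
    (fun t _ => ((hasDerivAt_line (fun z => hasDerivAt_multilinearExt f z (y - x)) x t).sub
      ((hasDerivAt_id t).mul_const _)).hasDerivWithinAt)
    (fun t ht => ?_)
  · simpa [sub_right_comm] using key
  · rw [one_mul]
    refine (abs_dirDeriv_sub_le h hx0 hx1 (segment_nonneg hx0 hy0 ht.1 ht.2.le)
      (segment_le_one hx1 hy1 ht.1 ht.2.le) _).trans ?_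
    have h1 : ∑ i, |(x + t • (y - x)) i - x i| ≤ ∑ i, |y i - x i| := by
      refine Finset.sum_le_sum fun i _ => ?_
      have : (x + t • (y - x)) i - x i = t * (y i - x i) := by simp
      rw [this, abs_mul, abs_of_nonneg ht.1]
      exact mul_le_of_le_one_left (abs_nonneg _) ht.2.le
    rw [sq, ← mul_assoc]
    refine mul_le_mul_of_nonneg_right ?_ (Finset.sum_nonneg fun i _ => abs_nonneg _)
    exact mul_le_mul_of_nonneg_left h1 (by positivity)

end MultilinearExtension

/-! ### Averaging over `G`, and the distance from the symmetric points -/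

section Symmetrization

variable {X : Type*} [Fintype X] [DecidableEq X] (G : Subgroup (Equiv.Perm X)) [Fintype G]

theorem symmetrize_apply (x : X → ℝ) (j : X) :
    symmetrize G x j = (∑ σ : G, x ((σ : Equiv.Perm X).symm j)) / (Fintype.card G : ℝ) := by
  unfold symmetrize
  congr!

omit [Fintype X] [DecidableEq X] in
theorem card_group_pos : (0 : ℝ) < Fintype.card G := by
  exact_mod_cast Fintype.card_pos

omit [Fintype G] in
theorem symmetrize_add (x y : X → ℝ) :
    symmetrize G (x + y) = symmetrize G x + symmetrize G y := by
  ext j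
  simp [symmetrize, Finset.sum_add_distrib, add_div]

omit [Fintype G] in
theorem symmetrize_smul (c : ℝ) (x : X → ℝ) : symmetrize G (c • x) = c • symmetrize G x := by
  ext j
  simp [symmetrize, ← Finset.mul_sum, mul_div_assoc]

/-- Symmetrization as a linear map. -/
noncomputable def symmetrizeLinear (G : Subgroup (Equiv.Perm X)) : (X → ℝ) →ₗ[ℝ] (X → ℝ) where
  toFun := symmetrize G
  map_add' := symmetrize_add G
  map_smul' := symmetrize_smul G

theorem symmetrize_comp_perm (x : X → ℝ) {σ : Equiv.Perm X} (hσ : σ ∈ G) :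
    symmetrize G (x ∘ σ) = symmetrize G x := by
  ext j
  rw [symmetrize_apply, symmetrize_apply]
  congr 1
  refine Fintype.sum_equiv (Equiv.mulRight (⟨σ, hσ⟩ : G)⁻¹) _ _ fun τ => ?_
  simp [Equiv.Perm.mul_def, Equiv.Perm.inv_def]

theorem symmetrize_perm (x : X → ℝ) {σ : Equiv.Perm X} (hσ : σ ∈ G) (j : X) :
    symmetrize G x (σ j) = symmetrize G x j := by
  rw [symmetrize_apply, symmetrize_apply]
  congr 1
  refine Fintype.sum_equiv (Equiv.mulLeft (⟨σ, hσ⟩ : G)⁻¹) _ _ fun τ => ?_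
  simp [Equiv.Perm.mul_def, Equiv.Perm.inv_def]

theorem symmetrize_of_invariant {x : X → ℝ} (h : ∀ σ ∈ G, ∀ j, x (σ j) = x j) :
    symmetrize G x = x := by
  ext j
  rw [symmetrize_apply, Finset.sum_congr rfl fun (σ : G) _ =>
    show x ((σ : Equiv.Perm X).symm j) = x j from h _ (G.inv_mem σ.2) j]
  simp

theorem symmetrize_symmetrize (x : X → ℝ) :
    symmetrize G (symmetrize G x) = symmetrize G x :=
  symmetrize_of_invariant G fun _ hσ j => symmetrize_perm G x hσ j

theorem symmetrize_mono {x y : X → ℝ} (h : x ≤ y) : symmetrize G x ≤ symmetrize G y := by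
  intro j
  rw [symmetrize_apply, symmetrize_apply]
  exact div_le_div_of_nonneg_right (Finset.sum_le_sum fun σ _ => h _) (card_group_pos G).le

theorem symmetrize_one : symmetrize G (1 : X → ℝ) = 1 :=
  symmetrize_of_invariant G fun _ _ _ => rfl

theorem symmetrize_zero : symmetrize G (0 : X → ℝ) = 0 :=
  symmetrize_of_invariant G fun _ _ _ => rfl

theorem symmetrize_nonneg {x : X → ℝ} (h : 0 ≤ x) : 0 ≤ symmetrize G x := by
  simpa [symmetrize_zero] using symmetrize_mono G h

theorem symmetrize_le_one {x : X → ℝ} (h : x ≤ 1) : symmetrize G x ≤ 1 := by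
  simpa [symmetrize_one] using symmetrize_mono G h

theorem sum_symmetrize (x : X → ℝ) : ∑ j, symmetrize G x j = ∑ j, x j := by
  simp only [symmetrize_apply]
  rw [← Finset.sum_div, Finset.sum_comm]
  have h : ∀ σ : G, ∑ j, x ((σ : Equiv.Perm X).symm j) = ∑ j, x j := fun σ =>
    Equiv.sum_comp (σ : Equiv.Perm X).symm x
  simp only [h, Finset.sum_const, Finset.card_univ, nsmul_eq_mul]
  rw [mul_div_cancel_left₀ _ (card_group_pos G).ne']

theorem multilinearExt_comp_perm {f : Finset X → ℝ} {σ : Equiv.Perm X}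
    (h : ∀ S : Finset X, f (S.map σ.toEmbedding) = f S) (x : X → ℝ) :
    multilinearExt f (x ∘ σ) = multilinearExt f x := by
  rw [multilinearExt_eq, multilinearExt_eq]
  refine Fintype.sum_equiv σ.finsetCongr _ _ fun S => ?_
  rw [Equiv.finsetCongr_apply, h]
  congr 1
  exact Fintype.prod_equiv σ _ _ fun i => by simp

theorem dirDeriv_comp_perm {f : Finset X → ℝ} {σ : Equiv.Perm X}
    (h : ∀ S : Finset X, f (S.map σ.toEmbedding) = f S) (v x : X → ℝ) :
    dirDeriv f (v ∘ σ) (x ∘ σ) = dirDeriv f v x := by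
  refine (hasDerivAt_multilinearExt f (x ∘ σ) (v ∘ σ)).unique ?_
  refine (hasDerivAt_multilinearExt f x v).congr_of_eventuallyEq ?_
  exact Filter.Eventually.of_forall fun s => multilinearExt_comp_perm h (x + s • v)

/-- At a symmetric point the gradient of an invariant `F` is itself invariant, so it does not
distinguish a direction from its average. -/
theorem dirDeriv_symmetrize {f : Finset X → ℝ}
    (h : ∀ σ ∈ G, ∀ S : Finset X, f (S.map σ.toEmbedding) = f S) (v x : X → ℝ) :
    dirDeriv f (symmetrize G v) (symmetrize G x) = dirDeriv f v (symmetrize G x) := by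
  have h1 : ∀ σ : G, dirDeriv f (v ∘ (σ : Equiv.Perm X).symm) (symmetrize G x) =
      dirDeriv f v (symmetrize G x) := by
    intro σ
    have h2 : symmetrize G x ∘ (σ : Equiv.Perm X).symm = symmetrize G x :=
      funext fun j => symmetrize_perm G x (G.inv_mem σ.2) j
    conv_lhs => rw [← h2]
    exact dirDeriv_comp_perm (h _ (G.inv_mem σ.2)) v (symmetrize G x)
  have h3 : dirDeriv f (symmetrize G v) (symmetrize G x) =
      (∑ σ : G, dirDeriv f (v ∘ (σ : Equiv.Perm X).symm) (symmetrize G x)) / Fintype.card G := by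
    unfold dirDeriv
    rw [Finset.sum_comm, Finset.sum_div]
    refine Finset.sum_congr rfl fun i _ => ?_
    rw [symmetrize_apply, ← Finset.sum_mul]
    simp only [Function.comp_apply]
    ring
  rw [h3]
  simp only [h1, Finset.sum_const, Finset.card_univ, nsmul_eq_mul]
  rw [mul_div_cancel_left₀ _ (card_group_pos G).ne']

/-- The squared distance of `x` from its symmetrization. -/
noncomputable def asymmetry (G : Subgroup (Equiv.Perm X)) (x : X → ℝ) : ℝ :=
  ∑ j, (x j - symmetrize G x j) ^ 2

/-- The derivative of `asymmetry` in direction `v`. -/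
noncomputable def asymmetryDeriv (G : Subgroup (Equiv.Perm X)) (v x : X → ℝ) : ℝ :=
  ∑ j, 2 * (x j - symmetrize G x j) * (v j - symmetrize G v j)

/-- The second derivative of `asymmetry` in directions `v` and `w`. -/
noncomputable def asymmetryDeriv₂ (G : Subgroup (Equiv.Perm X)) (v w : X → ℝ) : ℝ :=
  ∑ j, 2 * (w j - symmetrize G w j) * (v j - symmetrize G v j)

omit [Fintype G] in
theorem hasDerivAt_sub_symmetrize (x v : X → ℝ) (j : X) :
    HasDerivAt (fun s : ℝ => (x + s • v) j - symmetrize G (x + s • v) j)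
      (v j - symmetrize G v j) 0 := by
  simp only [symmetrize_add, symmetrize_smul, Pi.add_apply, Pi.smul_apply, smul_eq_mul]
  have h1 := ((hasDerivAt_id (0 : ℝ)).mul_const (v j)).const_add (x j)
  have h2 := ((hasDerivAt_id (0 : ℝ)).mul_const (symmetrize G v j)).const_add (symmetrize G x j)
  simpa using h1.fun_sub h2

omit [Fintype G] in
theorem hasDerivAt_asymmetry (x v : X → ℝ) :
    HasDerivAt (fun s : ℝ => asymmetry G (x + s • v)) (asymmetryDeriv G v x) 0 := by
  refine HasDerivAt.fun_sum fun j _ => ?_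
  have h := (hasDerivAt_sub_symmetrize G x v j).fun_pow 2
  exact h.congr_deriv (by simp)

omit [Fintype G] in
theorem hasDerivAt_asymmetryDeriv (v x w : X → ℝ) :
    HasDerivAt (fun s : ℝ => asymmetryDeriv G v (x + s • w)) (asymmetryDeriv₂ G v w) 0 :=
  HasDerivAt.fun_sum fun j _ => ((hasDerivAt_sub_symmetrize G x w j).const_mul 2).mul_const _

omit [Fintype G] in
theorem asymmetry_nonneg (x : X → ℝ) : 0 ≤ asymmetry G x :=
  Finset.sum_nonneg fun _ _ => sq_nonneg _

theorem asymmetry_symmetrize (x : X → ℝ) : asymmetry G (symmetrize G x) = 0 := by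
  simp [asymmetry, symmetrize_symmetrize]

omit [Fintype G] in
theorem sum_abs_sub_symmetrize_sq_le (x : X → ℝ) :
    (∑ j, |x j - symmetrize G x j|) ^ 2 ≤ Fintype.card X * asymmetry G x := by
  have := sq_sum_le_card_mul_sum_sq (s := Finset.univ) (f := fun j => |x j - symmetrize G x j|)
  simpa [asymmetry] using this

/-- Both terms lie in `[0, ∑ v]`, as averaging preserves the coordinate sum. Errors are measured by
`∑ v` because the derivatives of the penalty are. -/
theorem abs_sub_symmetrize_le {v : X → ℝ} (hv : 0 ≤ v) (j : X) :
    |v j - symmetrize G v j| ≤ ∑ i, v i := by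
  have h1 := hv j
  have h2 := symmetrize_nonneg G hv j
  have h3 : v j ≤ ∑ i, v i := Finset.single_le_sum (fun i _ => hv i) (Finset.mem_univ j)
  have h4 : symmetrize G v j ≤ ∑ i, symmetrize G v i :=
    Finset.single_le_sum (fun i _ => symmetrize_nonneg G hv i) (Finset.mem_univ j)
  rw [sum_symmetrize] at h4
  simp only [Pi.zero_apply] at h1 h2
  rw [abs_le]
  constructor <;> linarith

theorem abs_asymmetryDeriv_le {v : X → ℝ} (hv : 0 ≤ v) (x : X → ℝ) :
    |asymmetryDeriv G v x| ≤ 2 * (∑ j, |x j - symmetrize G x j|) * ∑ i, v i := by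
  unfold asymmetryDeriv
  rw [Finset.mul_sum _ _ 2, Finset.sum_mul]
  refine (Finset.abs_sum_le_sum_abs _ _).trans (Finset.sum_le_sum fun j _ => ?_)
  rw [abs_mul, abs_mul, abs_two]
  exact mul_le_mul_of_nonneg_left (abs_sub_symmetrize_le G hv j) (by positivity)

theorem abs_asymmetryDeriv₂_le {v w : X → ℝ} (hv : 0 ≤ v) (hw : 0 ≤ w) :
    |asymmetryDeriv₂ G v w| ≤ 2 * Fintype.card X * ((∑ i, v i) * ∑ i, w i) := by
  unfold asymmetryDeriv₂
  have h : ∀ j ∈ (Finset.univ : Finset X),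
      |2 * (w j - symmetrize G w j) * (v j - symmetrize G v j)| ≤
        2 * ((∑ i, v i) * ∑ i, w i) := by
    intro j _
    rw [abs_mul, abs_mul, abs_two, mul_assoc, mul_comm |w j - _|]
    have h1 := abs_sub_symmetrize_le G hv j
    have h2 := abs_sub_symmetrize_le G hw j
    gcongr
    exact Finset.sum_nonneg fun i _ => hv i
  refine (Finset.abs_sum_le_sum_abs _ _).trans ((Finset.sum_le_card_nsmul _ _ _ h).trans ?_)
  rw [nsmul_eq_mul, Finset.card_univ]
  exact le_of_eq (by ring)

section Gap

variable {f : Finset X → ℝ} {M : ℝ}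

/-- The defect `F(x) - F(x̄)` of the multilinear extension is of second order in `x - x̄`. -/
theorem abs_multilinearExt_sub_symmetrize_le (hM : ∀ S, |f S| ≤ M)
    (h : ∀ σ ∈ G, ∀ S : Finset X, f (S.map σ.toEmbedding) = f S) {x : X → ℝ} (h0 : 0 ≤ x)
    (h1 : x ≤ 1) :
    |multilinearExt f x - multilinearExt f (symmetrize G x)| ≤
      4 * M * (∑ j, |x j - symmetrize G x j|) ^ 2 := by
  have h2 := abs_multilinearExt_sub_sub_le hM (symmetrize_nonneg G h0) (symmetrize_le_one G h1)
    h0 h1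
  -- The linear Taylor term at `x̄` vanishes: the derivative there sees only the average of the
  -- direction, and `x - x̄` averages to zero.
  have h3 : dirDeriv f (x - symmetrize G x) (symmetrize G x) = 0 := by
    rw [← dirDeriv_symmetrize G h]
    have : symmetrize G (x - symmetrize G x) = 0 := by
      have := map_sub (symmetrizeLinear G) x (symmetrize G x)
      change symmetrize G (x - symmetrize G x) = symmetrize G x - symmetrize G (symmetrize G x)
        at this
      rw [this, symmetrize_symmetrize, sub_self]
    rw [this]
    simp [dirDeriv]
  rwa [h3, sub_zero] at h2

/-- `F` and `x ↦ F x̄` have the same gradient at `x̄`, so the derivative of their difference is of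
first order in `x - x̄`. -/
theorem abs_dirDeriv_sub_symmetrize_le (hM : ∀ S, |f S| ≤ M)
    (h : ∀ σ ∈ G, ∀ S : Finset X, f (S.map σ.toEmbedding) = f S) {x v : X → ℝ} (h0 : 0 ≤ x)
    (h1 : x ≤ 1) (hv : 0 ≤ v) :
    |dirDeriv f v x - dirDeriv f (symmetrize G v) (symmetrize G x)| ≤
      4 * M * (∑ j, |x j - symmetrize G x j|) * ∑ i, v i := by
  rw [dirDeriv_symmetrize G h]
  refine (abs_dirDeriv_sub_le hM (symmetrize_nonneg G h0) (symmetrize_le_one G h1)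
    h0 h1 v).trans (le_of_eq ?_)
  congr 1
  exact Finset.sum_congr rfl fun i _ => abs_of_nonneg (hv i)

omit [Fintype G] in
theorem hasDerivAt_multilinearExt_symmetrize (f : Finset X → ℝ) (x v : X → ℝ) :
    HasDerivAt (fun s : ℝ => multilinearExt f (symmetrize G (x + s • v)))
      (dirDeriv f (symmetrize G v) (symmetrize G x)) 0 := by
  simp only [symmetrize_add, symmetrize_smul]
  exact hasDerivAt_multilinearExt f _ _

omit [Fintype G] in
theorem hasDerivAt_dirDeriv_symmetrize (f : Finset X → ℝ) (v x w : X → ℝ) :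
    HasDerivAt (fun s : ℝ => dirDeriv f (symmetrize G v) (symmetrize G (x + s • w)))
      (dirDeriv₂ f (symmetrize G v) (symmetrize G w) (symmetrize G x)) 0 := by
  simp only [symmetrize_add, symmetrize_smul]
  exact hasDerivAt_dirDeriv f _ _ _

end Gap

end Symmetrization

/-! ### A cutoff with small logarithmic derivatives -/

section Cutoff

/-- A smooth step function has bounded first and second derivatives. -/
theorem exists_smooth_step : ∃ (ψ ψ₁ ψ₂ : ℝ → ℝ) (K : ℝ),
    (∀ s, HasDerivAt ψ (ψ₁ s) s) ∧ (∀ s, HasDerivAt ψ₁ (ψ₂ s) s) ∧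
    (∀ s ≤ 0, ψ s = 1) ∧ (∀ s, 1 ≤ s → ψ s = 0) ∧ (∀ s, 0 ≤ ψ s ∧ ψ s ≤ 1) ∧
    (∀ s, |ψ₁ s| ≤ K) ∧ ∀ s, |ψ₂ s| ≤ K := by
  set ψ : ℝ → ℝ := fun s => Real.smoothTransition (1 - s) with hψ
  have hc : ContDiff ℝ 2 ψ := by
    have : ContDiff ℝ 2 Real.smoothTransition := Real.smoothTransition.contDiff
    exact this.comp (contDiff_const.sub contDiff_id)
  have hc1 : ContDiff ℝ 1 (deriv ψ) := by
    have h := (contDiff_succ_iff_deriv (n := 1) (f := ψ)).1 (by rw [one_add_one_eq_two]; exact hc)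
    exact h.2.2
  have hc2 : Continuous (deriv (deriv ψ)) := hc1.continuous_deriv le_rfl
  have h0 : ∀ s ≤ 0, ψ s = 1 := fun s hs => Real.smoothTransition.one_of_one_le (by linarith)
  have h1 : ∀ s, 1 ≤ s → ψ s = 0 := fun s hs => Real.smoothTransition.zero_of_nonpos (by linarith)
  -- `ψ` is locally constant off `[0, 1]`, so compactness of that interval bounds both derivatives
  -- globally.
  have hd : ∀ s, s ∉ Set.Icc (0 : ℝ) 1 → deriv ψ s = 0 ∧ deriv (deriv ψ) s = 0 := by
    intro s hs
    have key : ∃ c : ℝ, ψ =ᶠ[nhds s] fun _ => c := by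
      rcases lt_or_ge s 0 with h | h
      · exact ⟨1, by filter_upwards [Iio_mem_nhds h] with t ht using h0 t (le_of_lt ht)⟩
      · have h' : 1 < s := by
          by_contra hh
          exact hs ⟨h, not_lt.1 hh⟩
        exact ⟨0, by filter_upwards [Ioi_mem_nhds h'] with t ht using h1 t (le_of_lt ht)⟩
    obtain ⟨c, hcst⟩ := key
    have e1 := hcst.deriv
    have e2 := e1.deriv
    refine ⟨by simpa using e1.eq_of_nhds, ?_⟩
    have := e2.eq_of_nhds
    simpa using this
  obtain ⟨K1, hK1⟩ := isCompact_Icc.exists_bound_of_continuousOn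
    (s := Set.Icc (0 : ℝ) 1) (hc1.continuous.continuousOn)
  obtain ⟨K2, hK2⟩ := isCompact_Icc.exists_bound_of_continuousOn
    (s := Set.Icc (0 : ℝ) 1) hc2.continuousOn
  have hz : (0 : ℝ) ≤ max K1 K2 :=
    ((norm_nonneg _).trans (hK1 0 (by simp))).trans (le_max_left _ _)
  refine ⟨ψ, deriv ψ, deriv (deriv ψ), max K1 K2,
    fun s => (hc.differentiable (by simp) s).hasDerivAt,
    fun s => (hc1.differentiable (by simp) s).hasDerivAt, h0, h1,
    fun s => ⟨Real.smoothTransition.nonneg _, Real.smoothTransition.le_one _⟩,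
    fun s => ?_, fun s => ?_⟩
  · by_cases hs : s ∈ Set.Icc (0 : ℝ) 1
    · exact (hK1 s hs).trans (le_max_left _ _)
    · rw [(hd s hs).1, abs_zero]
      exact hz
  · by_cases hs : s ∈ Set.Icc (0 : ℝ) 1
    · exact (hK2 s hs).trans (le_max_right _ _)
    · rw [(hd s hs).2, abs_zero]
      exact hz

/-- A cutoff function on a logarithmic scale: it falls from `1` to `0` so slowly that `t φ'` and
`t² φ''` are at most `α`. -/
theorem exists_log_cutoff {α β : ℝ} (hα : 0 < α) (hβ : 0 < β) :
    ∃ (δ : ℝ) (φ φ₁ φ₂ : ℝ → ℝ), 0 < δ ∧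
      (∀ t, HasDerivAt φ (φ₁ t) t) ∧ (∀ t, HasDerivAt φ₁ (φ₂ t) t) ∧
      (∀ t ≤ δ, φ t = 1) ∧ (∀ t, β ≤ t → φ t = 0) ∧ (∀ t, 0 ≤ φ t ∧ φ t ≤ 1) ∧
      (∀ t, |φ₁ t| * |t| ≤ α) ∧ ∀ t, |φ₂ t| * t ^ 2 ≤ α := by
  obtain ⟨ψ, ψ₁, ψ₂, K, hd1, hd2, h0, h1, h01, hK1, hK2⟩ := exists_smooth_step
  have hK : 0 ≤ K := (abs_nonneg _).trans (hK1 0)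
  -- the slope on the logarithmic scale
  obtain ⟨a, ha0, ha1, haα⟩ : ∃ a : ℝ, 0 < a ∧ a ≤ 1 ∧ 2 * K * a ≤ α := by
    refine ⟨min 1 (α / (2 * K + 1)), by positivity, min_le_left _ _, ?_⟩
    have h2 : min 1 (α / (2 * K + 1)) ≤ α / (2 * K + 1) := min_le_right _ _
    calc 2 * K * min 1 (α / (2 * K + 1)) ≤ (2 * K + 1) * (α / (2 * K + 1)) := by
          gcongr
          linarith
      _ = α := by field_simp
  -- Chosen so that `a * log (t / δ)` runs from `0` at `t = δ` to `1` at `t = β`.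
  set δ : ℝ := β * Real.exp (-(1 / a)) with hδ
  have hδ0 : 0 < δ := by positivity
  have hδβ : Real.log (β / δ) = 1 / a := by
    have : β / δ = Real.exp (1 / a) := by
      rw [hδ, Real.exp_neg]
      field_simp
    rw [this, Real.log_exp]
  set ℓ : ℝ → ℝ := fun t => a * Real.log (t / δ) with hℓ
  have hℓd : ∀ t, 0 < t → HasDerivAt ℓ (a / t) t := by
    intro t ht
    have h2 : HasDerivAt (fun t : ℝ => t / δ) (1 / δ) t := (hasDerivAt_id t).div_const δ
    have h3 := (h2.log (by positivity)).const_mul a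
    refine h3.congr_deriv ?_
    field_simp
  -- The value `1` is imposed below `δ` because `Real.log` has junk values for `t ≤ 0`, while `D =
  -- 0` does occur.
  set φ : ℝ → ℝ := fun t => if t ≤ δ then 1 else ψ (ℓ t) with hφ
  set φ₁ : ℝ → ℝ := fun t => if t ≤ δ then 0 else ψ₁ (ℓ t) * (a / t) with hφ1
  set φ₂ : ℝ → ℝ := fun t => if t ≤ δ then 0 else
    ψ₂ (ℓ t) * (a / t) * (a / t) + ψ₁ (ℓ t) * (-a / t ^ 2) with hφ2
  -- One-sided uniqueness of derivatives includes the endpoint `s = 0`, which is where the two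
  -- branches are glued.
  have hψ1 : ∀ s ≤ 0, ψ₁ s = 0 := by
    intro s hs
    have e : HasDerivWithinAt ψ 0 (Set.Iic s) s :=
      (hasDerivWithinAt_const s (Set.Iic s) (1 : ℝ)).congr
        (fun t ht => h0 t (le_trans ht hs)) (h0 s hs)
    exact (uniqueDiffOn_Iic s s Set.self_mem_Iic).eq_deriv _ (hd1 s).hasDerivWithinAt e
  have hψ2 : ∀ s ≤ 0, ψ₂ s = 0 := by
    intro s hs
    have e : HasDerivWithinAt ψ₁ 0 (Set.Iic s) s :=
      (hasDerivWithinAt_const s (Set.Iic s) (0 : ℝ)).congr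
        (fun t ht => hψ1 t (le_trans ht hs)) (hψ1 s hs)
    exact (uniqueDiffOn_Iic s s Set.self_mem_Iic).eq_deriv _ (hd2 s).hasDerivWithinAt e
  have hℓ0 : ∀ t, 0 < t → t ≤ δ → ℓ t ≤ 0 := by
    intro t ht0 ht
    refine mul_nonpos_of_nonneg_of_nonpos ha0.le (Real.log_nonpos (by positivity) ?_)
    rwa [div_le_one hδ0]
  -- on the positive axis the case distinction is redundant
  have eφ : ∀ t, 0 < t → φ t = ψ (ℓ t) := by
    intro t ht
    by_cases h : t ≤ δ
    · simp only [hφ, h, if_true]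
      rw [h0 _ (hℓ0 t ht h)]
    · simp [hφ, h]
  have eφ1 : ∀ t, 0 < t → φ₁ t = ψ₁ (ℓ t) * (a / t) := by
    intro t ht
    by_cases h : t ≤ δ
    · simp only [hφ1, h, if_true]
      rw [hψ1 _ (hℓ0 t ht h), zero_mul]
    · simp [hφ1, h]
  have eφ2 : ∀ t, 0 < t → φ₂ t =
      ψ₂ (ℓ t) * (a / t) * (a / t) + ψ₁ (ℓ t) * (-a / t ^ 2) := by
    intro t ht
    by_cases h : t ≤ δ
    · simp only [hφ2, h, if_true]
      rw [hψ1 _ (hℓ0 t ht h), hψ2 _ (hℓ0 t ht h)]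
      ring
    · simp [hφ2, h]
  refine ⟨δ, φ, φ₁, φ₂, hδ0, fun t => ?_, fun t => ?_, fun t ht => by simp [hφ, ht], fun t ht => ?_,
    fun t => ?_, fun t => ?_, fun t => ?_⟩
  · rcases lt_or_ge t δ with ht | ht
    · have e : φ =ᶠ[nhds t] fun _ => 1 := by
        filter_upwards [Iio_mem_nhds ht] with s hs
        simp [hφ, le_of_lt (Set.mem_Iio.1 hs)]
      have e1 : φ₁ t = 0 := by simp [hφ1, ht.le]
      rw [e1]
      exact (hasDerivAt_const t (1 : ℝ)).congr_of_eventuallyEq e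
    · have ht0 : 0 < t := hδ0.trans_le ht
      have e : φ =ᶠ[nhds t] fun s => ψ (ℓ s) := by
        filter_upwards [Ioi_mem_nhds ht0] with s hs using eφ s hs
      rw [eφ1 t ht0]
      exact ((hd1 (ℓ t)).comp t (hℓd t ht0)).congr_of_eventuallyEq e
  · rcases lt_or_ge t δ with ht | ht
    · have e : φ₁ =ᶠ[nhds t] fun _ => 0 := by
        filter_upwards [Iio_mem_nhds ht] with s hs
        simp [hφ1, le_of_lt (Set.mem_Iio.1 hs)]
      have e1 : φ₂ t = 0 := by simp [hφ2, ht.le]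
      rw [e1]
      exact (hasDerivAt_const t (0 : ℝ)).congr_of_eventuallyEq e
    · have ht0 : 0 < t := hδ0.trans_le ht
      have e : φ₁ =ᶠ[nhds t] fun s => ψ₁ (ℓ s) * (a / s) := by
        filter_upwards [Ioi_mem_nhds ht0] with s hs using eφ1 s hs
      rw [eφ2 t ht0]
      have h2 : HasDerivAt (fun s : ℝ => a / s) (-a / t ^ 2) t := by
        have := (hasDerivAt_inv ht0.ne').const_mul a
        simp only [← div_eq_mul_inv] at this
        exact this.congr_deriv (by ring)
      exact (((hd2 (ℓ t)).comp t (hℓd t ht0)).mul h2).congr_of_eventuallyEq e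
  · have ht0 : 0 < t := hβ.trans_le ht
    rw [eφ t ht0]
    refine h1 _ ?_
    have h2 : Real.log (β / δ) ≤ Real.log (t / δ) := by
      apply Real.log_le_log (by positivity)
      gcongr
    rw [hδβ] at h2
    calc (1 : ℝ) = a * (1 / a) := by field_simp
      _ ≤ ℓ t := mul_le_mul_of_nonneg_left h2 ha0.le
  · by_cases h : t ≤ δ
    · simp [hφ, h]
    · simpa [hφ, h] using h01 (ℓ t)
  · rcases le_or_gt t δ with h | h
    · simp [hφ1, h, hα.le]
    · have ht0 : 0 < t := hδ0.trans h
      rw [eφ1 t ht0, abs_mul, abs_of_pos (div_pos ha0 ht0), abs_of_pos ht0, mul_assoc,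
        div_mul_cancel₀ _ ht0.ne']
      nlinarith [mul_le_mul_of_nonneg_right (hK1 (ℓ t)) ha0.le, mul_nonneg hK ha0.le]
  · rcases le_or_gt t δ with h | h
    · simp [hφ2, h, hα.le]
    · have ht0 : 0 < t := hδ0.trans h
      -- The powers of `t` cancel by scale invariance of the logarithm; since `a ≤ 1`, the result is
      -- at most `2 * K * a ≤ α`.
      have e : |φ₂ t| * t ^ 2 = |ψ₂ (ℓ t) * a * a - ψ₁ (ℓ t) * a| := by
        rw [eφ2 t ht0, ← abs_of_pos (pow_pos ht0 2), ← abs_mul, abs_of_pos (pow_pos ht0 2)]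
        congr 1
        field_simp
        ring
      rw [e]
      have h2 := abs_sub (ψ₂ (ℓ t) * a * a) (ψ₁ (ℓ t) * a)
      rw [abs_mul, abs_mul, abs_mul, abs_of_pos ha0] at h2
      have h3 : |ψ₂ (ℓ t)| * a * a ≤ K * a * 1 := by
        have := hK2 (ℓ t)
        gcongr
      have h4 : |ψ₁ (ℓ t)| * a ≤ K * a := mul_le_mul_of_nonneg_right (hK1 _) ha0.le
      linarith

end Cutoff

/-! ### Making the multilinear extension flat near the symmetric points -/

section Smoothing

/-- A nonnegative function on the cube with diminishing returns along nonnegative directions,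
monotone if the option `mono` is switched on. -/
structure IsDRFunction {X : Type*} (mono : Prop) (Φ : (X → ℝ) → ℝ) : Prop where
  nonneg : ∀ x, 0 ≤ x → x ≤ 1 → 0 ≤ Φ x
  diminishing : ∀ x v w, 0 ≤ x → 0 ≤ v → 0 ≤ w → x + v + w ≤ 1 →
    Φ (x + v + w) + Φ x ≤ Φ (x + v) + Φ (x + w)
  concave : ∀ (x v : X → ℝ) (t : ℝ), 0 ≤ x → 0 ≤ v → x + v ≤ 1 → 0 ≤ t → t ≤ 1 →
    (1 - t) * Φ x + t * Φ (x + v) ≤ Φ (x + t • v)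
  monotone : mono → ∀ x v, 0 ≤ x → 0 ≤ v → x + v ≤ 1 → Φ x ≤ Φ (x + v)

theorem antitoneOn_unitInterval_of_hasDerivAt {g g' : ℝ → ℝ} (hd : ∀ t, HasDerivAt g (g' t) t)
    (h : ∀ t, 0 ≤ t → t ≤ 1 → g' t ≤ 0) : AntitoneOn g (Set.Icc 0 1) := by
  refine antitoneOn_of_hasDerivWithinAt_nonpos (convex_Icc 0 1)
    (fun t _ => (hd t).continuousAt.continuousWithinAt)
    (fun t _ => (hd t).hasDerivWithinAt) fun t ht => ?_
  rw [interior_Icc] at ht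
  exact h t ht.1.le ht.2.le

/-- Nonpositive second derivatives make `Φ₁ v` antitone along each nonnegative `w`. Integrating
along `v` gives diminishing returns, and the case `w = v` gives concavity. -/
theorem IsDRFunction.of_hasDerivAt {X : Type*} {mono : Prop} {Φ : (X → ℝ) → ℝ}
    {Φ₁ : (X → ℝ) → (X → ℝ) → ℝ} {Φ₂ : (X → ℝ) → (X → ℝ) → (X → ℝ) → ℝ}
    (hd1 : ∀ v x, HasDerivAt (fun s : ℝ => Φ (x + s • v)) (Φ₁ v x) 0)
    (hd2 : ∀ v w x, HasDerivAt (fun s : ℝ => Φ₁ v (x + s • w)) (Φ₂ v w x) 0)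
    (h0 : ∀ x, 0 ≤ x → x ≤ 1 → 0 ≤ Φ x)
    (h1 : mono → ∀ v x, 0 ≤ x → x ≤ 1 → 0 ≤ v → 0 ≤ Φ₁ v x)
    (h2 : ∀ v w x, 0 ≤ x → x ≤ 1 → 0 ≤ v → 0 ≤ w → Φ₂ v w x ≤ 0) : IsDRFunction mono Φ := by
  have hmem0 : ∀ {x v : X → ℝ} {t : ℝ}, 0 ≤ x → 0 ≤ v → 0 ≤ t → 0 ≤ x + t • v := by
    intro x v t hx hv ht
    exact add_nonneg hx (smul_nonneg ht hv)
  have hle : ∀ {x v : X → ℝ} {t : ℝ}, 0 ≤ v → t ≤ 1 → x + t • v ≤ x + v := by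
    intro x v t hv ht i
    have := hv i
    simp only [Pi.zero_apply, Pi.add_apply, Pi.smul_apply, smul_eq_mul] at *
    nlinarith
  have hanti : ∀ v w x, 0 ≤ x → 0 ≤ v → 0 ≤ w → x + w ≤ 1 →
      AntitoneOn (fun s : ℝ => Φ₁ v (x + s • w)) (Set.Icc 0 1) := by
    intro v w x hx hv hw hxw
    exact antitoneOn_unitInterval_of_hasDerivAt (fun t => hasDerivAt_line (hd2 v w) x t)
      fun t ht0 ht1 => h2 v w _ (hmem0 hx hw ht0) ((hle hw ht1).trans hxw) hv hw
  refine ⟨h0, fun x v w hx hv hw hs => ?_, fun x v t hx hv hs ht0 ht1 => ?_,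
    fun hm x v hx hv hs => ?_⟩
  · have hant : AntitoneOn (fun t : ℝ => Φ (x + w + t • v) - Φ (x + t • v)) (Set.Icc 0 1) := by
      refine antitoneOn_unitInterval_of_hasDerivAt
        (fun t => (hasDerivAt_line (hd1 v) (x + w) t).fun_sub (hasDerivAt_line (hd1 v) x t))
        fun t ht0 ht1 => ?_
      have hle' : x + t • v + w ≤ 1 := (add_le_add_left (hle hv ht1) w).trans hs
      have := hanti v w (x + t • v) (hmem0 hx hv ht0) hv hw hle' (by simp) (by simp) zero_le_one
      simp only [one_smul, zero_smul, add_zero] at this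
      rw [add_right_comm x w]
      linarith
    have := hant (by simp) (by simp) zero_le_one
    simp only [one_smul, zero_smul, add_zero] at this
    rw [add_right_comm x w] at this
    linarith
  · have hline := fun t => hasDerivAt_line (hd1 v) x t
    have hconc : ConcaveOn ℝ (Set.Icc 0 1) fun s : ℝ => Φ (x + s • v) := by
      refine AntitoneOn.concaveOn_of_deriv (convex_Icc 0 1)
        (fun t _ => (hline t).continuousAt.continuousWithinAt)
        (fun t _ => (hline t).differentiableAt.differentiableWithinAt) ?_
      have he : deriv (fun s : ℝ => Φ (x + s • v)) = fun s => Φ₁ v (x + s • v) :=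
        funext fun t => (hline t).deriv
      rw [he]
      exact (hanti v v x hx hv hv hs).mono interior_subset
    have := hconc.2 (x := 0) (y := 1) (by simp) (by simp) (sub_nonneg.2 ht1) ht0 (by ring)
    simpa using this
  · have hmon := antitoneOn_unitInterval_of_hasDerivAt
      (fun t => (hasDerivAt_line (hd1 v) x t).fun_neg)
      fun t ht0 ht1 => neg_nonpos.2 (h1 hm v _ (hmem0 hx hv ht0) ((hle hv ht1).trans hs) hv)
    have := hmon (by simp) (by simp) zero_le_one
    simpa using this

variable {X : Type*} [Fintype X]

/-- A concave symmetric penalty with large first and negative second derivatives. -/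
noncomputable def penalty (x : X → ℝ) : ℝ :=
  3 * (Fintype.card X + 1) * (∑ i, x i) - (∑ i, x i) ^ 2

theorem hasDerivAt_sum_line (x v : X → ℝ) :
    HasDerivAt (fun s : ℝ => ∑ i, (x + s • v) i) (∑ i, v i) 0 := by
  refine HasDerivAt.fun_sum fun i _ => ?_
  simpa using ((hasDerivAt_id (0 : ℝ)).mul_const (v i)).const_add (x i)

theorem hasDerivAt_penalty (v x : X → ℝ) :
    HasDerivAt (fun s : ℝ => penalty (x + s • v))
      ((3 * (Fintype.card X + 1) - 2 * ∑ i, x i) * ∑ i, v i) 0 := by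
  have h := hasDerivAt_sum_line x v
  refine ((h.const_mul (3 * (Fintype.card X + 1 : ℝ))).fun_sub (h.fun_pow 2)).congr_deriv ?_
  simp
  ring

theorem hasDerivAt_penaltyDeriv (v w x : X → ℝ) :
    HasDerivAt (fun s : ℝ => (3 * (Fintype.card X + 1) - 2 * ∑ i, (x + s • w) i) * ∑ i, v i)
      (-2 * ((∑ i, v i) * ∑ i, w i)) 0 := by
  have h := hasDerivAt_sum_line x w
  refine (((h.const_mul 2).const_sub _).mul_const _).congr_deriv ?_
  ring

theorem sum_nonneg_of_cube {x : X → ℝ} (h0 : 0 ≤ x) : 0 ≤ ∑ i, x i :=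
  Finset.sum_nonneg fun i _ => h0 i

theorem sum_le_card_of_cube {x : X → ℝ} (h1 : x ≤ 1) : ∑ i, x i ≤ Fintype.card X := by
  simpa using Finset.sum_le_sum fun i (_ : i ∈ Finset.univ) => h1 i

variable [DecidableEq X] (G : Subgroup (Equiv.Perm X)) [Fintype G]

set_option maxHeartbeats 1000000 in
/-- For a `G`-invariant submodular `f` the multilinear extension can be perturbed, preserving
diminishing returns, so that near the symmetric points it depends only on the symmetrization. -/
theorem exists_isDRFunction {mono : Prop} {f : Finset X → ℝ} (hf : IsObjective mono f)
    (hinv : ∀ σ ∈ G, ∀ S : Finset X, f (S.map σ.toEmbedding) = f S) {e : ℝ} (he : 0 < e) :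
    ∃ (δ : ℝ) (Φ : (X → ℝ) → ℝ), 0 < δ ∧ IsDRFunction mono Φ ∧
      (∀ x, 0 ≤ x → x ≤ 1 → |Φ x - multilinearExt f x| ≤ e) ∧
      ∀ x, asymmetry G x ≤ δ → Φ x = Φ (symmetrize G x) := by
  obtain ⟨M, hM0, hM⟩ : ∃ M : ℝ, 0 ≤ M ∧ ∀ S, |f S| ≤ M :=
    ⟨∑ S, |f S|, Finset.sum_nonneg fun _ _ => abs_nonneg _,
      fun S => Finset.single_le_sum (fun S _ => abs_nonneg (f S)) (Finset.mem_univ S)⟩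
  set m : ℝ := ((Fintype.card X : ℕ) : ℝ) with hm
  have hm0 : 0 ≤ m := Nat.cast_nonneg _
  -- `C` is the Taylor constant of `F`. `κ` makes the penalty cost at most `e / 2`; `B` dominates
  -- the coefficients of all error terms, and `α` makes `B * α ≤ κ`; `β` makes `|H| ≤ e / 2`
  -- wherever `φ` is nonzero.
  set C : ℝ := 4 * M with hC
  have hC0 : 0 ≤ C := by positivity
  set κ : ℝ := e / (6 * (m + 1) ^ 2) with hκ
  have hκ0 : 0 < κ := by positivity
  set B : ℝ := 10 * (m + 1) ^ 2 * C with hB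
  have hB0 : 0 ≤ B := by positivity
  set α : ℝ := κ / (B + 1) with hα
  have hα0 : 0 < α := by positivity
  have hBα : B * α ≤ κ := by
    rw [hα, ← mul_div_assoc, div_le_iff₀ (by positivity)]
    nlinarith
  set β : ℝ := e / (2 * (C * m + 1)) with hβ
  have hβ0 : 0 < β := by positivity
  have hCβ : C * m * β ≤ e / 2 := by
    have : (C * m + 1) * β = e / 2 := by rw [hβ]; field_simp
    nlinarith
  obtain ⟨δ, φ, φ₁, φ₂, hδ, hd1, hd2, hone, hzero, h01, hb1, hb2⟩ :=
    exists_log_cutoff hα0 hβ0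
  set Fm := multilinearExt f with hFm
  set D := asymmetry G with hD
  set H : (X → ℝ) → ℝ := fun x => Fm x - Fm (symmetrize G x) with hH
  set H₁ : (X → ℝ) → (X → ℝ) → ℝ :=
    fun v x => dirDeriv f v x - dirDeriv f (symmetrize G v) (symmetrize G x) with hH1
  set H₂ : (X → ℝ) → (X → ℝ) → (X → ℝ) → ℝ := fun v w x => dirDeriv₂ f v w x -
    dirDeriv₂ f (symmetrize G v) (symmetrize G w) (symmetrize G x) with hH2
  have hdH : ∀ v x, HasDerivAt (fun s : ℝ => H (x + s • v)) (H₁ v x) 0 := fun v x =>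
    (hasDerivAt_multilinearExt f x v).fun_sub (hasDerivAt_multilinearExt_symmetrize G f x v)
  have hdH1 : ∀ v w x, HasDerivAt (fun s : ℝ => H₁ v (x + s • w)) (H₂ v w x) 0 := fun v w x =>
    (hasDerivAt_dirDeriv f v x w).fun_sub (hasDerivAt_dirDeriv_symmetrize G f v x w)
  have at0 : ∀ x v : X → ℝ, x + (0 : ℝ) • v = x := fun x v => by simp
  have hdφ : ∀ v x, HasDerivAt (fun s : ℝ => φ (D (x + s • v)))
      (φ₁ (D x) * asymmetryDeriv G v x) 0 := by
    intro v x
    have h := hasDerivAt_asymmetry G x v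
    have h' := (hd1 (D (x + (0 : ℝ) • v))).comp (0 : ℝ) h
    rwa [at0] at h'
  have hdφ1 : ∀ v w x, HasDerivAt (fun s : ℝ => φ₁ (D (x + s • w)) *
      asymmetryDeriv G v (x + s • w)) (φ₂ (D x) * asymmetryDeriv G w x * asymmetryDeriv G v x +
        φ₁ (D x) * asymmetryDeriv₂ G v w) 0 := by
    intro v w x
    have h := hasDerivAt_asymmetry G x w
    have h' := (hd2 (D (x + (0 : ℝ) • w))).comp (0 : ℝ) h
    have h'' := h'.fun_mul (hasDerivAt_asymmetryDeriv G v x w)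
    simpa only [at0, Function.comp_apply] using h''
  -- Interpolates between `F x̄` (where `φ = 1`) and `F x` (where `φ = 0`), up to the penalty. `Φ₁`
  -- and `Φ₂` are its derivatives by the product rule.
  set Φ : (X → ℝ) → ℝ := fun x => Fm x - φ (D x) * H x + κ * penalty x with hΦ
  set Φ₁ : (X → ℝ) → (X → ℝ) → ℝ := fun v x => dirDeriv f v x -
    (φ₁ (D x) * asymmetryDeriv G v x * H x + φ (D x) * H₁ v x) +
    κ * ((3 * (m + 1) - 2 * ∑ i, x i) * ∑ i, v i) with hΦ1
  set Φ₂ : (X → ℝ) → (X → ℝ) → (X → ℝ) → ℝ := fun v w x => dirDeriv₂ f v w x -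
    (((φ₂ (D x) * asymmetryDeriv G w x * asymmetryDeriv G v x +
        φ₁ (D x) * asymmetryDeriv₂ G v w) * H x +
      φ₁ (D x) * asymmetryDeriv G v x * H₁ w x) +
    (φ₁ (D x) * asymmetryDeriv G w x * H₁ v x + φ (D x) * H₂ v w x)) +
    κ * (-2 * ((∑ i, v i) * ∑ i, w i)) with hΦ2
  have hdΦ : ∀ v x, HasDerivAt (fun s : ℝ => Φ (x + s • v)) (Φ₁ v x) 0 := by
    intro v x
    have h := ((hasDerivAt_multilinearExt f x v).fun_sub ((hdφ v x).fun_mul (hdH v x))).fun_add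
      ((hasDerivAt_penalty v x).const_mul κ)
    simpa only [at0] using h
  have hdΦ1 : ∀ v w x, HasDerivAt (fun s : ℝ => Φ₁ v (x + s • w)) (Φ₂ v w x) 0 := by
    intro v w x
    have h := ((hasDerivAt_dirDeriv f v x w).fun_sub
      (((hdφ1 v w x).fun_mul (hdH w x)).fun_add ((hdφ w x).fun_mul (hdH1 v w x)))).fun_add
      ((hasDerivAt_penaltyDeriv v w x).const_mul κ)
    simpa only [at0] using h
  -- bounds on the cube
  have hr : ∀ x, (∑ j, |x j - symmetrize G x j|) ^ 2 ≤ m * D x :=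
    fun x => sum_abs_sub_symmetrize_sq_le G x
  have hD0 : ∀ x, 0 ≤ D x := fun x => asymmetry_nonneg G x
  have hbH : ∀ x, 0 ≤ x → x ≤ 1 → |H x| ≤ C * (m * D x) := fun x h0 h1 =>
    (abs_multilinearExt_sub_symmetrize_le G hM hinv h0 h1).trans
      (mul_le_mul_of_nonneg_left (hr x) hC0)
  have hbφ1 : ∀ x, |φ₁ (D x)| * D x ≤ α := fun x => by
    simpa [abs_of_nonneg (hD0 x)] using hb1 (D x)
  have hpen0 : ∀ x : X → ℝ, 0 ≤ x → x ≤ 1 → 0 ≤ penalty x := by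
    intro x h0 h1
    have h2 := sum_nonneg_of_cube h0
    have h3 := sum_le_card_of_cube h1
    unfold penalty
    nlinarith
  have hpen1 : ∀ x : X → ℝ, 0 ≤ x → x ≤ 1 → penalty x ≤ 3 * (m + 1) ^ 2 := by
    intro x h0 h1
    have h2 := sum_nonneg_of_cube h0
    have h3 := sum_le_card_of_cube h1
    unfold penalty
    nlinarith
  refine ⟨δ, Φ, hδ, IsDRFunction.of_hasDerivAt hdΦ hdΦ1 ?_ ?_ ?_, ?_, ?_⟩
  · intro x h0 h1
    have e1 : Φ x = (1 - φ (D x)) * Fm x + φ (D x) * Fm (symmetrize G x) + κ * penalty x := by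
      simp only [hΦ, hH]
      ring
    have h2 := multilinearExt_nonneg h0 h1 hf.nonneg
    have h3 := multilinearExt_nonneg (symmetrize_nonneg G h0) (symmetrize_le_one G h1) hf.nonneg
    have h4 := h01 (D x)
    have h5 := hpen0 x h0 h1
    rw [e1]
    exact add_nonneg (add_nonneg (mul_nonneg (by linarith) h2) (mul_nonneg h4.1 h3))
      (mul_nonneg hκ0.le h5)
  · intro hmono v x h0 h1 hv
    have e1 : Φ₁ v x = (1 - φ (D x)) * dirDeriv f v x +
        φ (D x) * dirDeriv f (symmetrize G v) (symmetrize G x) -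
        φ₁ (D x) * asymmetryDeriv G v x * H x +
        κ * ((3 * (m + 1) - 2 * ∑ i, x i) * ∑ i, v i) := by
      simp only [hΦ1, hH1]
      ring
    have hN := sum_nonneg_of_cube hv
    have h2 := dirDeriv_nonneg (hf.monotone hmono) h0 h1 hv
    have h3 := dirDeriv_nonneg (hf.monotone hmono) (symmetrize_nonneg G h0)
      (symmetrize_le_one G h1) (symmetrize_nonneg G hv)
    have h4 := h01 (D x)
    have hs := sum_le_card_of_cube h1
    have hrm : ∑ j, |x j - symmetrize G x j| ≤ m := by
      have : ∀ j ∈ (Finset.univ : Finset X), |x j - symmetrize G x j| ≤ 1 := by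
        intro j _
        have a1 := h0 j
        have a2 := h1 j
        have a3 := symmetrize_nonneg G h0 j
        have a4 := symmetrize_le_one G h1 j
        simp only [Pi.zero_apply, Pi.one_apply] at a1 a2 a3 a4
        rw [abs_le]
        constructor <;> linarith
      simpa [hm] using Finset.sum_le_sum this
    have h5 : |φ₁ (D x) * asymmetryDeriv G v x * H x| ≤ κ * ∑ i, v i := by
      rw [abs_mul, abs_mul]
      calc |φ₁ (D x)| * |asymmetryDeriv G v x| * |H x|
          ≤ |φ₁ (D x)| * (2 * m * ∑ i, v i) * (C * (m * D x)) := by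
            refine mul_le_mul (mul_le_mul_of_nonneg_left ?_ (abs_nonneg _)) (hbH x h0 h1)
              (abs_nonneg _) (by positivity)
            refine (abs_asymmetryDeriv_le G hv x).trans ?_
            gcongr
        _ = (|φ₁ (D x)| * D x) * (2 * m ^ 2 * C * ∑ i, v i) := by ring
        _ ≤ α * (2 * m ^ 2 * C * ∑ i, v i) :=
            mul_le_mul_of_nonneg_right (hbφ1 x) (by positivity)
        _ ≤ α * (B * ∑ i, v i) := by
            refine mul_le_mul_of_nonneg_left (mul_le_mul_of_nonneg_right ?_ hN) hα0.le
            rw [hB]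
            refine mul_le_mul_of_nonneg_right ?_ hC0
            nlinarith
        _ = (B * α) * ∑ i, v i := by ring
        _ ≤ κ * ∑ i, v i := mul_le_mul_of_nonneg_right hBα hN
    -- On the cube `∑ x ≤ m`, so the slope of the penalty is at least `m + 3` and absorbs the error
    -- `h5`.
    have h6 : κ * ∑ i, v i ≤ κ * ((3 * (m + 1) - 2 * ∑ i, x i) * ∑ i, v i) := by
      refine mul_le_mul_of_nonneg_left ?_ hκ0.le
      refine le_mul_of_one_le_left hN ?_
      linarith
    have h7 := (abs_le.1 h5).2
    have h8 : 0 ≤ (1 - φ (D x)) * dirDeriv f v x := mul_nonneg (by linarith) h2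
    have h9 := mul_nonneg h4.1 h3
    rw [e1]
    linarith
  · intro v w x h0 h1 hv hw
    -- A convex combination of two nonpositive Hessians, plus terms with derivatives of `φ`. With `r
    -- = ∑ |x - x̄|`, `r² ≤ m * D`, `D' = O(r)`, `H = O(D)` and `H' = O(r)`, each of those terms
    -- carries `|φ₁| * D` or `|φ₂| * D²`, hence a factor `α`.
    have e1 : Φ₂ v w x = (1 - φ (D x)) * dirDeriv₂ f v w x +
        φ (D x) * dirDeriv₂ f (symmetrize G v) (symmetrize G w) (symmetrize G x) -
        (φ₂ (D x) * asymmetryDeriv G w x * asymmetryDeriv G v x * H x +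
        φ₁ (D x) * asymmetryDeriv₂ G v w * H x +
        φ₁ (D x) * asymmetryDeriv G v x * H₁ w x +
        φ₁ (D x) * asymmetryDeriv G w x * H₁ v x) -
        2 * κ * ((∑ i, v i) * ∑ i, w i) := by
      simp only [hΦ2, hH2]
      ring
    set N : ℝ := (∑ i, v i) * ∑ i, w i with hNdef
    set r : ℝ := ∑ j, |x j - symmetrize G x j| with hrdef
    have hr0 : 0 ≤ r := Finset.sum_nonneg fun _ _ => abs_nonneg _
    have hNv := sum_nonneg_of_cube hv
    have hNw := sum_nonneg_of_cube hw
    have hN0 : 0 ≤ N := mul_nonneg hNv hNw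
    have h2 := dirDeriv₂_nonpos hf.submodular h0 h1 hv hw
    have h3 := dirDeriv₂_nonpos hf.submodular (symmetrize_nonneg G h0) (symmetrize_le_one G h1)
      (symmetrize_nonneg G hv) (symmetrize_nonneg G hw)
    have h4 := h01 (D x)
    have hDx := hD0 x
    have hDv := abs_asymmetryDeriv_le G hv x
    have hDw := abs_asymmetryDeriv_le G hw x
    have hHv := abs_dirDeriv_sub_symmetrize_le G hM hinv h0 h1 hv
    have hHw := abs_dirDeriv_sub_symmetrize_le G hM hinv h0 h1 hw
    have hHx := hbH x h0 h1
    have t1 : |φ₂ (D x) * asymmetryDeriv G w x * asymmetryDeriv G v x * H x| ≤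
        4 * m ^ 2 * C * α * N := by
      rw [abs_mul, abs_mul, abs_mul]
      calc |φ₂ (D x)| * |asymmetryDeriv G w x| * |asymmetryDeriv G v x| * |H x|
          ≤ |φ₂ (D x)| * (2 * r * ∑ i, w i) * (2 * r * ∑ i, v i) * (C * (m * D x)) := by
            gcongr
        _ = r ^ 2 * (|φ₂ (D x)| * D x * (4 * m * C * N)) := by rw [hNdef]; ring
        _ ≤ (m * D x) * (|φ₂ (D x)| * D x * (4 * m * C * N)) :=
            mul_le_mul_of_nonneg_right (hr x) (by positivity)
        _ = (|φ₂ (D x)| * D x ^ 2) * (4 * m ^ 2 * C * N) := by ring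
        _ ≤ α * (4 * m ^ 2 * C * N) := mul_le_mul_of_nonneg_right (hb2 _) (by positivity)
        _ = _ := by ring
    have t2 : |φ₁ (D x) * asymmetryDeriv₂ G v w * H x| ≤ 2 * m ^ 2 * C * α * N := by
      rw [abs_mul, abs_mul]
      calc |φ₁ (D x)| * |asymmetryDeriv₂ G v w| * |H x|
          ≤ |φ₁ (D x)| * (2 * m * N) * (C * (m * D x)) := by
            have := abs_asymmetryDeriv₂_le G hv hw
            gcongr
        _ = (|φ₁ (D x)| * D x) * (2 * m ^ 2 * C * N) := by ring
        _ ≤ α * (2 * m ^ 2 * C * N) := mul_le_mul_of_nonneg_right (hbφ1 x) (by positivity)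
        _ = _ := by ring
    have t34 : ∀ a b : X → ℝ, 0 ≤ a → 0 ≤ b → (∑ i, a i) * (∑ i, b i) = N →
        |φ₁ (D x) * asymmetryDeriv G a x * H₁ b x| ≤ 2 * m * C * α * N := by
      intro a b ha hb hab
      have hNa := sum_nonneg_of_cube ha
      have hNb := sum_nonneg_of_cube hb
      rw [abs_mul, abs_mul]
      calc |φ₁ (D x)| * |asymmetryDeriv G a x| * |H₁ b x|
          ≤ |φ₁ (D x)| * (2 * r * ∑ i, a i) * (C * r * ∑ i, b i) := by
            have i1 := abs_asymmetryDeriv_le G ha x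
            have i2 := abs_dirDeriv_sub_symmetrize_le G hM hinv h0 h1 hb
            gcongr
        _ = r ^ 2 * (|φ₁ (D x)| * (2 * C * N)) := by rw [← hab]; ring
        _ ≤ (m * D x) * (|φ₁ (D x)| * (2 * C * N)) :=
            mul_le_mul_of_nonneg_right (hr x) (by positivity)
        _ = (|φ₁ (D x)| * D x) * (2 * m * C * N) := by ring
        _ ≤ α * (2 * m * C * N) := mul_le_mul_of_nonneg_right (hbφ1 x) (by positivity)
        _ = _ := by ring
    have t3 := t34 v w hv hw rfl
    have t4 := t34 w v hw hv (mul_comm _ _)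
    have h5 : (6 * m ^ 2 + 4 * m) * C * α * N ≤ κ * N := by
      refine mul_le_mul_of_nonneg_right (le_trans ?_ hBα) hN0
      refine mul_le_mul_of_nonneg_right ?_ hα0.le
      rw [hB]
      refine mul_le_mul_of_nonneg_right ?_ hC0
      nlinarith
    have h6 : 0 ≤ κ * N := by positivity
    have h7 : (1 - φ (D x)) * dirDeriv₂ f v w x ≤ 0 :=
      mul_nonpos_of_nonneg_of_nonpos (by linarith) h2
    have h8 := mul_nonpos_of_nonneg_of_nonpos h4.1 h3
    have t1' := (abs_le.1 t1).1
    have t2' := (abs_le.1 t2).1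
    have t3' := (abs_le.1 t3).1
    have t4' := (abs_le.1 t4).1
    rw [e1]
    linarith
  · intro x h0 h1
    have e1 : Φ x - Fm x = κ * penalty x - φ (D x) * H x := by
      simp only [hΦ]
      ring
    have h2 : |φ (D x) * H x| ≤ e / 2 := by
      rcases le_or_gt β (D x) with h | h
      · rw [hzero _ h]
        simp
        positivity
      · rw [abs_mul, abs_of_nonneg (h01 _).1]
        calc φ (D x) * |H x| ≤ 1 * (C * (m * D x)) :=
              mul_le_mul (h01 _).2 (hbH x h0 h1) (abs_nonneg _) zero_le_one
          _ = C * m * D x := by ring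
          _ ≤ C * m * β := by gcongr
          _ ≤ e / 2 := hCβ
    have h3 : κ * penalty x ≤ e / 2 := by
      calc κ * penalty x ≤ κ * (3 * (m + 1) ^ 2) :=
            mul_le_mul_of_nonneg_left (hpen1 x h0 h1) hκ0.le
        _ = e / 2 := by rw [hκ]; field_simp; norm_num
    have h4 : 0 ≤ κ * penalty x := mul_nonneg hκ0.le (hpen0 x h0 h1)
    have h5 := abs_le.1 h2
    rw [e1, abs_le]
    constructor <;> linarith [h5.1, h5.2]
  -- Here `φ = 1` at both `x` and `x̄`, so only `F x̄` and the penalty remain; the penalty depends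
  -- on the coordinate sum, which averaging preserves.
  · intro x hx
    have e1 : penalty (symmetrize G x) = penalty x := by
      unfold penalty
      rw [sum_symmetrize]
    have e2 : D (symmetrize G x) = 0 := asymmetry_symmetrize G x
    simp only [hΦ, hH, symmetrize_symmetrize, e1, e2, hone _ hx]
    ring

end Smoothing

/-! ### From functions on the cube to set functions -/

section Lifting

variable {U : Type*} [DecidableEq U]

theorem indVec_nonneg (S : Finset U) : 0 ≤ indVec S := by
  intro i
  by_cases h : i ∈ S <;> simp [indVec, h]

theorem indVec_le_one (S : Finset U) : indVec S ≤ 1 := by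
  intro i
  by_cases h : i ∈ S <;> simp [indVec, h]

theorem indVec_eq_inter_add_sdiff (S T : Finset U) :
    indVec S = indVec (S ∩ T) + indVec (S \ T) := by
  ext i
  by_cases h : i ∈ S <;> by_cases h' : i ∈ T <;> simp [indVec, h, h']

theorem indVec_union (S T : Finset U) :
    indVec (S ∪ T) = indVec (S ∩ T) + indVec (S \ T) + indVec (T \ S) := by
  ext i
  by_cases h : i ∈ S <;> by_cases h' : i ∈ T <;> simp [indVec, h, h']

theorem indVec_insert {a : U} {R : Finset U} (h : a ∉ R) :
    indVec (insert a R) = Pi.single a 1 + indVec R := by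
  ext i
  by_cases hi : i = a
  · subst hi
    simp [indVec, h]
  · simp [indVec, hi]

theorem feasiblePolytope_subset_cube (F : Set (Finset U)) {z : U → ℝ}
    (hz : z ∈ feasiblePolytope F) : 0 ≤ z ∧ z ≤ 1 := by
  have h : feasiblePolytope F ⊆ Set.Icc 0 1 := by
    refine convexHull_min ?_ (convex_Icc 0 1)
    rintro _ ⟨S, _, rfl⟩
    exact ⟨indVec_nonneg S, indVec_le_one S⟩
  exact h hz

/-- A linear map preserving nonnegativity, which maps the unit cube to the unit cube. -/
structure IsSubstochastic {V W : Type*} (L : (V → ℝ) →ₗ[ℝ] (W → ℝ)) : Prop where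
  nonneg : ∀ z, 0 ≤ z → 0 ≤ L z
  one_le : L 1 ≤ 1

theorem IsSubstochastic.mono {V W : Type*} {L : (V → ℝ) →ₗ[ℝ] (W → ℝ)} (hL : IsSubstochastic L)
    {y z : V → ℝ} (h : y ≤ z) : L y ≤ L z := by
  have := hL.nonneg (z - y) (sub_nonneg.2 h)
  rw [map_sub] at this
  exact sub_nonneg.1 this

theorem IsSubstochastic.le_one {V W : Type*} {L : (V → ℝ) →ₗ[ℝ] (W → ℝ)}
    (hL : IsSubstochastic L) {z : V → ℝ} (h : z ≤ 1) : L z ≤ 1 :=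
  (hL.mono h).trans hL.one_le

theorem IsSubstochastic.comp {V W Y : Type*} {L : (V → ℝ) →ₗ[ℝ] (W → ℝ)}
    {L' : (W → ℝ) →ₗ[ℝ] (Y → ℝ)} (hL' : IsSubstochastic L') (hL : IsSubstochastic L) :
    IsSubstochastic (L' ∘ₗ L) :=
  ⟨fun z hz => hL'.nonneg _ (hL.nonneg z hz), hL'.le_one hL.one_le⟩

variable {X : Type*} {mono : Prop} {Φ : (X → ℝ) → ℝ} {L : (U → ℝ) →ₗ[ℝ] (X → ℝ)}

/-- Submodularity is diminishing returns at the image of `S ∩ T` with the increments `S \ T` and `T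
\ S`, since `L` is additive and positive. -/
theorem IsDRFunction.isObjective (hΦ : IsDRFunction mono Φ) (hL : IsSubstochastic L) :
    IsObjective mono fun S : Finset U => Φ (L (indVec S)) := by
  refine ⟨fun S => hΦ.nonneg _ (hL.nonneg _ (indVec_nonneg S)) (hL.le_one (indVec_le_one S)),
    fun S T => ?_, fun hm S T hST => ?_⟩
  · have h := hΦ.diminishing (L (indVec (S ∩ T))) (L (indVec (S \ T))) (L (indVec (T \ S)))
      (hL.nonneg _ (indVec_nonneg _)) (hL.nonneg _ (indVec_nonneg _))
      (hL.nonneg _ (indVec_nonneg _))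
    rw [← map_add, ← map_add, ← map_add, ← indVec_union, ← indVec_eq_inter_add_sdiff] at h
    have e : indVec (S ∩ T) + indVec (T \ S) = indVec T := by
      rw [Finset.inter_comm]
      exact (indVec_eq_inter_add_sdiff T S).symm
    rw [e] at h
    exact h (hL.le_one (indVec_le_one _))
  · have e : indVec T = indVec S + indVec (T \ S) := by
      rw [indVec_eq_inter_add_sdiff T S, Finset.inter_eq_right.2 hST]
    have h := hΦ.monotone hm (L (indVec S)) (L (indVec (T \ S)))
      (hL.nonneg _ (indVec_nonneg _)) (hL.nonneg _ (indVec_nonneg _))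
    rw [← map_add, ← e] at h
    exact h (hL.le_one (indVec_le_one _))

/-- Rounding the coordinates in `A` independently does not increase the expectation of `Φ ∘ L`,
because `Φ ∘ L` is concave in each coordinate. -/
theorem IsDRFunction.sum_powerset_le (hΦ : IsDRFunction mono Φ) (hL : IsSubstochastic L)
    {z : U → ℝ} (h0 : 0 ≤ z) (h1 : z ≤ 1) (A : Finset U) :
    ∀ y : U → ℝ, 0 ≤ y → y ≤ 1 → (∀ u ∈ A, y u = 0) →
      ∑ R ∈ A.powerset, Φ (L (y + indVec R)) * ∏ i ∈ A, (if i ∈ R then z i else 1 - z i) ≤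
        Φ (L (y + fun u => if u ∈ A then z u else 0)) := by
  induction A using Finset.induction_on with
  | empty =>
    intro y _ _ _
    have : indVec (∅ : Finset U) = fun _ => 0 := by
      ext
      simp [indVec]
    simp [this]
  | insert a A ha ih =>
    intro y hy0 hy1 hyA
    have hza0 := h0 a
    have hza1 := h1 a
    simp only [Pi.zero_apply, Pi.one_apply] at hza0 hza1
    have hya : y a = 0 := hyA a (Finset.mem_insert_self a A)
    have hne : ∀ u ∈ A, u ≠ a := fun u hu h => ha (h ▸ hu)
    -- Conditioning on the rounding of `a`. If `a` is rounded up it moves into the offset `y`, so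
    -- the induction needs arbitrary `y`; the two cases are recombined by concavity in direction
    -- `a`.
    rw [Finset.sum_powerset_insert ha]
    have s1 : ∑ R ∈ A.powerset, Φ (L (y + indVec R)) *
        ∏ i ∈ insert a A, (if i ∈ R then z i else 1 - z i) =
        (1 - z a) * ∑ R ∈ A.powerset, Φ (L (y + indVec R)) *
          ∏ i ∈ A, (if i ∈ R then z i else 1 - z i) := by
      rw [Finset.mul_sum]
      refine Finset.sum_congr rfl fun R hR => ?_
      have haR : a ∉ R := fun h => ha (Finset.mem_powerset.1 hR h)
      rw [Finset.prod_insert ha, if_neg haR]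
      ring
    have s2 : ∑ R ∈ A.powerset, Φ (L (y + indVec (insert a R))) *
        ∏ i ∈ insert a A, (if i ∈ insert a R then z i else 1 - z i) =
        z a * ∑ R ∈ A.powerset, Φ (L (y + Pi.single a 1 + indVec R)) *
          ∏ i ∈ A, (if i ∈ R then z i else 1 - z i) := by
      rw [Finset.mul_sum]
      refine Finset.sum_congr rfl fun R hR => ?_
      have haR : a ∉ R := fun h => ha (Finset.mem_powerset.1 hR h)
      rw [Finset.prod_insert ha, if_pos (Finset.mem_insert_self a R), indVec_insert haR,
        add_assoc y]
      have : ∏ i ∈ A, (if i ∈ insert a R then z i else 1 - z i) =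
          ∏ i ∈ A, (if i ∈ R then z i else 1 - z i) :=
        Finset.prod_congr rfl fun i hi => by simp [hne i hi]
      rw [this]
      ring
    have i1 := ih y hy0 hy1 fun u hu => hyA u (Finset.mem_insert_of_mem hu)
    have hs0 : (0 : U → ℝ) ≤ Pi.single a 1 := Pi.single_nonneg.2 zero_le_one
    have i2 := ih (y + Pi.single a 1) (add_nonneg hy0 hs0)
      (by
        intro u
        by_cases h : u = a
        · subst h
          simp [hya]
        · simpa [h] using hy1 u)
      fun u hu => by simp [hne u hu, hyA u (Finset.mem_insert_of_mem hu)]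
    set q : U → ℝ := y + fun u => if u ∈ A then z u else 0 with hq
    have hq0 : 0 ≤ q := by
      refine add_nonneg hy0 fun u => ?_
      by_cases h : u ∈ A
      · simpa [h] using h0 u
      · simp [h]
    have hq1 : q + Pi.single a 1 ≤ 1 := by
      intro u
      by_cases h : u = a
      · subst h
        simp [hq, ha, hya]
      · by_cases h' : u ∈ A
        · simpa [hq, h, h', hyA u (Finset.mem_insert_of_mem h')] using h1 u
        · simpa [hq, h, h'] using hy1 u
    have e2 : (y + Pi.single a 1 + fun u => if u ∈ A then z u else 0) = q + Pi.single a 1 := by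
      rw [hq, add_right_comm]
    have e3 : (y + fun u => if u ∈ insert a A then z u else 0) = q + z a • Pi.single a 1 := by
      ext u
      by_cases h : u = a
      · subst h
        simp [hq, ha, hya]
      · simp [hq, h]
    have hc := hΦ.concave (L q) (L (Pi.single a 1)) (z a) (hL.nonneg _ hq0) (hL.nonneg _ hs0)
      (by rw [← map_add]; exact hL.le_one hq1) hza0 hza1
    rw [← map_add, ← map_smul, ← map_add] at hc
    rw [e2] at i2
    rw [s1, s2, e3]
    refine le_trans (add_le_add ?_ ?_) hc
    · exact mul_le_mul_of_nonneg_left i1 (by linarith)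
    · exact mul_le_mul_of_nonneg_left i2 hza0

theorem IsDRFunction.multilinearExt_le [Fintype U] (hΦ : IsDRFunction mono Φ)
    (hL : IsSubstochastic L) {z : U → ℝ} (h0 : 0 ≤ z) (h1 : z ≤ 1) :
    multilinearExt (fun S : Finset U => Φ (L (indVec S))) z ≤ Φ (L z) := by
  have h := hΦ.sum_powerset_le hL h0 h1 Finset.univ 0 le_rfl zero_le_one fun _ _ => rfl
  rw [multilinearExt_eq]
  simpa using h

end Lifting

/-! ### Hidden clusterings and feasibility in the refinement -/

section Clusters

variable {X : Type*} {n : ℕ}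

/-- The cluster fractions of `z` with respect to the clusters `{(i, τᵢ j) : i ∈ N}`, `j ∈ X`. -/
noncomputable def clusterMap (τ : Fin n → Equiv.Perm X) : (Fin n × X → ℝ) →ₗ[ℝ] (X → ℝ) where
  toFun z j := (∑ i, z (i, τ i j)) / n
  map_add' y z := by
    ext j
    simp [Finset.sum_add_distrib, add_div]
  map_smul' c z := by
    ext j
    simp [← Finset.mul_sum, mul_div_assoc]

theorem clusterMap_apply (τ : Fin n → Equiv.Perm X) (z : Fin n × X → ℝ) (j : X) :
    clusterMap τ z j = (∑ i, z (i, τ i j)) / n := rfl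

theorem isSubstochastic_clusterMap (τ : Fin n → Equiv.Perm X) :
    IsSubstochastic (clusterMap τ) := by
  refine ⟨fun z hz j => ?_, fun j => ?_⟩
  · rw [clusterMap_apply]
    exact div_nonneg (Finset.sum_nonneg fun i _ => hz _) (Nat.cast_nonneg n)
  · rw [clusterMap_apply]
    simpa using div_self_le_one (n : ℝ)

theorem clusterFraction_eq [DecidableEq X] (S : Finset (Fin n × X)) :
    clusterFraction S = clusterMap (fun _ => 1) (indVec S) := by
  ext j
  rw [clusterMap_apply, clusterFraction]
  congr 1
  have hcard : ∑ i : Fin n, indVec S (i, j) =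
      ((Finset.univ.filter fun i : Fin n => (i, j) ∈ S).card : ℝ) := by
    rw [Finset.card_filter]
    push_cast
    rfl
  simp only [Equiv.Perm.coe_one, id_eq]
  rw [hcard]
  congr 1
  refine Finset.card_bij' (fun u _ => u.1) (fun i _ => (i, j)) ?_ ?_ ?_ ?_
  · rintro ⟨i, k⟩ h
    simp only [Finset.mem_filter] at h
    obtain ⟨h, rfl⟩ := h
    simpa using h
  · intro i h
    simpa using h
  · rintro ⟨i, k⟩ h
    simp only [Finset.mem_filter] at h
    rw [h.2]
  · intro i _
    rfl

variable [Fintype X] [DecidableEq X] (G : Subgroup (Equiv.Perm X)) [Fintype G]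

theorem isSubstochastic_symmetrizeLinear : IsSubstochastic (symmetrizeLinear G) :=
  ⟨fun _ hz => symmetrize_nonneg G hz, symmetrize_le_one G le_rfl⟩

/-- Copy `i` contributes `z(i, ·) ∘ τ i`, and averaging over `G` absorbs `τ i`. Hence a single
oracle `g`, independent of `τ`, can imitate all hidden clusterings. -/
theorem symmetrize_clusterMap (τ : Fin n → G) (z : Fin n × X → ℝ) :
    symmetrize G (clusterMap (fun i => (τ i : Equiv.Perm X)) z) =
      symmetrize G (clusterMap (fun _ => 1) z) := by
  have key : ∀ τ : Fin n → G, clusterMap (fun i => (τ i : Equiv.Perm X)) z =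
      (n : ℝ)⁻¹ • ∑ i, (fun j => z (i, j)) ∘ (τ i : Equiv.Perm X) := by
    intro τ
    ext j
    simp [clusterMap_apply, div_eq_inv_mul]
  have h := fun τ => congrArg (symmetrizeLinear G) (key τ)
  have h1 : ∀ τ : Fin n → G, symmetrize G (clusterMap (fun i => (τ i : Equiv.Perm X)) z) =
      (n : ℝ)⁻¹ • ∑ i, symmetrize G (fun j => z (i, j)) := by
    intro τ
    refine (h τ).trans ?_
    rw [map_smul, map_sum]
    congr 1
    exact Finset.sum_congr rfl fun i _ => symmetrize_comp_perm G _ (τ i).2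
  exact (h1 τ).trans (h1 fun _ => 1).symm

omit [Fintype X] in
theorem clusterMap_mem_of_mem_refinement {F : Set (Finset X)} {z : Fin n × X → ℝ}
    (hz : z ∈ feasiblePolytope (refinement n F)) :
    clusterMap (fun _ => 1) z ∈ feasiblePolytope F := by
  have h : feasiblePolytope (refinement n F) ⊆
      (clusterMap fun _ : Fin n => (1 : Equiv.Perm X)) ⁻¹' feasiblePolytope F := by
    refine convexHull_min ?_ ((convex_convexHull ℝ _).linear_preimage _)
    rintro _ ⟨S, hS, rfl⟩
    have hS' : clusterFraction S ∈ feasiblePolytope F := hS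
    rwa [clusterFraction_eq] at hS'
  exact h hz

/-- `T` and `σ(T)` have the same symmetrized indicator vector. -/
theorem map_mem_of_stronglySymmetric {f : Finset X → ℝ} {F : Set (Finset X)}
    (h : StronglySymmetric f F G) {σ : Equiv.Perm X} (hσ : σ ∈ G) {T : Finset X} (hT : T ∈ F) :
    T.map σ.toEmbedding ∈ F := by
  refine (h.feasible_iff T _ ?_).1 hT
  have : indVec T = indVec (T.map σ.toEmbedding) ∘ σ := by
    ext j
    simp [indVec]
  rw [this, symmetrize_comp_perm G _ hσ]

/-- The set which selects `σᵢ(Tᵢ)` in the copy `i` of the ground set. -/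
def bundle (τ : Fin n → G) (T : Fin n → Finset X) : Finset (Fin n × X) :=
  Finset.univ.filter fun u => u.2 ∈ (T u.1).map (τ u.1 : Equiv.Perm X).toEmbedding

omit [Fintype G] in
-- The hidden clustering undoes the twist: through it one sees the plain average of the `T i`.
theorem clusterMap_bundle (τ : Fin n → G) (T : Fin n → Finset X) (j : X) :
    clusterMap (fun i => (τ i : Equiv.Perm X)) (indVec (bundle G τ T)) j =
      (∑ i, indVec (T i) j) / n := by
  rw [clusterMap_apply]
  congr 1
  refine Finset.sum_congr rfl fun i _ => ?_
  simp [indVec, bundle]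

/-- Feasibility is judged by the public clusters, whose fractions are the average of the indicators
of the feasible sets `τ i (T i)`. -/
theorem bundle_mem_refinement {f : Finset X → ℝ} {F : Set (Finset X)}
    (h : StronglySymmetric f F G) (hn : 0 < n) (τ : Fin n → G) {T : Fin n → Finset X}
    (hT : ∀ i, T i ∈ F) : bundle G τ T ∈ refinement n F := by
  change clusterFraction _ ∈ feasiblePolytope F
  have e : clusterFraction (bundle G τ T) =
      ∑ i : Fin n, (n : ℝ)⁻¹ • indVec ((T i).map (τ i : Equiv.Perm X).toEmbedding) := by
    rw [clusterFraction_eq]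
    ext j
    rw [clusterMap_apply, Finset.sum_apply, div_eq_inv_mul, Finset.mul_sum]
    refine Finset.sum_congr rfl fun i _ => ?_
    simp [indVec, bundle]
  rw [e]
  refine (convex_convexHull ℝ _).sum_mem (fun i _ => by positivity) ?_ fun i _ =>
    subset_convexHull ℝ _ ⟨_, map_mem_of_stronglySymmetric G h (τ i).2 (hT i), rfl⟩
  have : (n : ℝ) ≠ 0 := by positivity
  simp [this]

end Clusters

/-! ### Concentration of the cluster fractions -/

section Concentration

/-- A Chernoff bound for the number of `τ` at which a sum of centered terms is large. -/
theorem card_filter_le_exp {Γ : Type*} [Fintype Γ] [DecidableEq Γ] {n : ℕ} (Z : Fin n → Γ → ℝ)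
    (hZ : ∀ i g, |Z i g| ≤ 1) (hmean : ∀ i, ∑ g, Z i g = 0) {a : ℝ} (ha0 : 0 ≤ a) (ha1 : a ≤ 1) :
    ((Finset.univ.filter fun τ : Fin n → Γ => n * a ≤ ∑ i, Z i (τ i)).card : ℝ) ≤
      (Fintype.card Γ : ℝ) ^ n * Real.exp (-(n * a ^ 2 / 4)) := by
  -- Minimizes the exponent `-l * a + l²`, which gives `-a² / 4`.
  set l : ℝ := a / 2 with hl
  have hl0 : 0 ≤ l := by positivity
  have hl1 : l ≤ 1 := by linarith
  have h1 : ((Finset.univ.filter fun τ : Fin n → Γ => n * a ≤ ∑ i, Z i (τ i)).card : ℝ) ≤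
      ∑ τ : Fin n → Γ, Real.exp (-(l * (n * a))) * ∏ i, Real.exp (l * Z i (τ i)) := by
    rw [Finset.card_filter]
    push_cast
    refine Finset.sum_le_sum fun τ _ => ?_
    rw [← Real.exp_sum, ← Real.exp_add, ← Finset.mul_sum]
    split_ifs with h
    · rw [Real.one_le_exp_iff]
      nlinarith
    · exact (Real.exp_pos _).le
  refine h1.trans ?_
  have hswap := Finset.prod_univ_sum (fun _ : Fin n => (Finset.univ : Finset Γ))
    fun i g => Real.exp (l * Z i g)
  rw [Fintype.piFinset_univ] at hswap
  rw [← Finset.mul_sum, ← hswap]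
  -- Uses `exp x ≤ 1 + x + x²` for `|x| ≤ 1`; the linear term sums to zero.
  have h2 : ∀ i, ∑ g, Real.exp (l * Z i g) ≤ Fintype.card Γ * Real.exp (l ^ 2) := by
    intro i
    have h3 : ∀ g, Real.exp (l * Z i g) ≤ 1 + l * Z i g + l ^ 2 := by
      intro g
      have h4 : |l * Z i g| ≤ l := by
        rw [abs_mul, abs_of_nonneg hl0]
        exact mul_le_of_le_one_right hl0 (hZ i g)
      have h5 := (abs_le.1 (Real.abs_exp_sub_one_sub_id_le (h4.trans hl1))).2
      have h6 : (l * Z i g) ^ 2 ≤ l ^ 2 := sq_le_sq.2 (by rwa [abs_of_nonneg hl0])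
      linarith
    calc ∑ g, Real.exp (l * Z i g) ≤ ∑ g, (1 + l * Z i g + l ^ 2) :=
          Finset.sum_le_sum fun g _ => h3 g
      _ = Fintype.card Γ * (l ^ 2 + 1) := by
          rw [Finset.sum_add_distrib, Finset.sum_add_distrib, ← Finset.mul_sum, hmean i]
          simp
          ring
      _ ≤ Fintype.card Γ * Real.exp (l ^ 2) :=
          mul_le_mul_of_nonneg_left (Real.add_one_le_exp _) (Nat.cast_nonneg _)
  calc Real.exp (-(l * (n * a))) * ∏ i, ∑ g, Real.exp (l * Z i g)
      ≤ Real.exp (-(l * (n * a))) * ∏ _i : Fin n, (Fintype.card Γ * Real.exp (l ^ 2)) := by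
        refine mul_le_mul_of_nonneg_left ?_ (Real.exp_pos _).le
        exact Finset.prod_le_prod
          (fun i _ => Finset.sum_nonneg fun g _ => (Real.exp_pos _).le) fun i _ => h2 i
    _ = (Fintype.card Γ : ℝ) ^ n * Real.exp (-(n * a ^ 2 / 4)) := by
        rw [Finset.prod_const, Finset.card_univ, Fintype.card_fin, mul_pow, ← Real.exp_nat_mul,
          mul_left_comm, ← Real.exp_add]
        congr 2
        rw [hl]
        ring

variable {X : Type*} [Fintype X] [DecidableEq X] (G : Subgroup (Equiv.Perm X)) [Fintype G]

/-- Every fixed set is nearly symmetric with respect to most random clusterings. -/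
theorem card_asymmetry_gt_le {n : ℕ} (hn : 0 < n) {a δ : ℝ} (ha0 : 0 < a) (ha1 : a ≤ 1)
    (haδ : Fintype.card X * a ^ 2 ≤ δ) (S : Finset (Fin n × X)) :
    ((Finset.univ.filter fun τ : Fin n → G =>
      δ < asymmetry G (clusterMap (fun i => (τ i : Equiv.Perm X)) (indVec S))).card : ℝ) ≤
      2 * Fintype.card X * ((Fintype.card G : ℝ) ^ n * Real.exp (-(n * a ^ 2 / 4))) := by
  classical
  have hn' : (0 : ℝ) < n := Nat.cast_pos.2 hn
  set p : Fin n → X → ℝ := fun i => symmetrize G fun j => indVec S (i, j) with hp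
  set Z : X → Fin n → G → ℝ :=
    fun j i σ => indVec S (i, (σ : Equiv.Perm X) j) - p i j with hZ
  have hp0 : ∀ i j, 0 ≤ p i j ∧ p i j ≤ 1 := fun i j =>
    ⟨symmetrize_nonneg G (fun j => indVec_nonneg S (i, j)) j,
      symmetrize_le_one G (fun j => indVec_le_one S (i, j)) j⟩
  have hZ1 : ∀ j i σ, |Z j i σ| ≤ 1 := by
    intro j i σ
    have h1 := indVec_nonneg S (i, (σ : Equiv.Perm X) j)
    have h2 := indVec_le_one S (i, (σ : Equiv.Perm X) j)
    have h3 := hp0 i j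
    simp only [Pi.zero_apply, Pi.one_apply] at h1 h2
    rw [abs_le]
    constructor <;> simp only [hZ] <;> linarith [h3.1, h3.2]
  have hZ0 : ∀ j i, ∑ σ, Z j i σ = 0 := by
    intro j i
    have h1 : ∑ σ : G, indVec S (i, (σ : Equiv.Perm X) j) =
        ∑ σ : G, indVec S (i, (σ : Equiv.Perm X).symm j) :=
      Fintype.sum_equiv (Equiv.inv G) _ _ fun σ => by simp [Equiv.Perm.inv_def]
    simp only [hZ, hp]
    rw [Finset.sum_sub_distrib, h1, Finset.sum_const, Finset.card_univ, symmetrize_apply,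
      nsmul_eq_mul, mul_div_cancel₀ _ (card_group_pos G).ne', sub_self]
  -- The symmetrized fractions are the average of the means `p i` and do not depend on `τ`, so the
  -- deviation is an average of independent centered terms.
  have hdev : ∀ (τ : Fin n → G) (j : X),
      clusterMap (fun i => (τ i : Equiv.Perm X)) (indVec S) j -
        symmetrize G (clusterMap (fun i => (τ i : Equiv.Perm X)) (indVec S)) j =
      (∑ i, Z j i (τ i)) / n := by
    intro τ j
    have h1 : clusterMap (fun _ => 1) (indVec S) =
        (n : ℝ)⁻¹ • ∑ i, fun j => indVec S (i, j) := by
      ext j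
      simp [clusterMap_apply, div_eq_inv_mul]
    have h2 : symmetrize G (clusterMap (fun _ => 1) (indVec S)) = (n : ℝ)⁻¹ • ∑ i, p i := by
      have := congrArg (symmetrizeLinear G) h1
      rw [map_smul, map_sum] at this
      exact this
    rw [symmetrize_clusterMap, h2, clusterMap_apply]
    simp only [hZ, Pi.smul_apply, Finset.sum_apply, smul_eq_mul, Finset.sum_sub_distrib]
    ring
  -- If every coordinate deviates by less than `a`, the asymmetry is at most `m * a² ≤ δ`; a union
  -- bound over `2 * m` one-sided tails remains.
  have hsub : (Finset.univ.filter fun τ : Fin n → G =>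
      δ < asymmetry G (clusterMap (fun i => (τ i : Equiv.Perm X)) (indVec S))) ⊆
      Finset.univ.biUnion fun j : X =>
        (Finset.univ.filter fun τ : Fin n → G => n * a ≤ ∑ i, Z j i (τ i)) ∪
        (Finset.univ.filter fun τ : Fin n → G => n * a ≤ ∑ i, -Z j i (τ i)) := by
    intro τ hτ
    by_contra hcon
    simp only [Finset.mem_biUnion, Finset.mem_union, Finset.mem_filter, Finset.mem_univ,
      true_and, not_exists, not_or, not_le, Finset.sum_neg_distrib] at hcon
    have hlt : δ < asymmetry G (clusterMap (fun i => (τ i : Equiv.Perm X)) (indVec S)) := by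
      simpa using hτ
    refine absurd hlt (not_lt.2 (le_trans ?_ haδ))
    unfold asymmetry
    have : ∀ j ∈ (Finset.univ : Finset X),
        (clusterMap (fun i => (τ i : Equiv.Perm X)) (indVec S) j -
          symmetrize G (clusterMap (fun i => (τ i : Equiv.Perm X)) (indVec S)) j) ^ 2 ≤ a ^ 2 := by
      intro j _
      rw [hdev, sq_le_sq, abs_of_pos ha0, abs_div, abs_of_pos hn', div_le_iff₀ hn', abs_le]
      constructor <;> nlinarith [(hcon j).1, (hcon j).2]
    simpa using Finset.sum_le_sum this
  calc ((Finset.univ.filter fun τ : Fin n → G =>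
      δ < asymmetry G (clusterMap (fun i => (τ i : Equiv.Perm X)) (indVec S))).card : ℝ)
      ≤ ((Finset.univ.biUnion fun j : X =>
        (Finset.univ.filter fun τ : Fin n → G => n * a ≤ ∑ i, Z j i (τ i)) ∪
        (Finset.univ.filter fun τ : Fin n → G => n * a ≤ ∑ i, -Z j i (τ i))).card : ℝ) := by
        exact_mod_cast Finset.card_le_card hsub
    _ ≤ ∑ j : X, (((Finset.univ.filter fun τ : Fin n → G => n * a ≤ ∑ i, Z j i (τ i)) ∪
        (Finset.univ.filter fun τ : Fin n → G => n * a ≤ ∑ i, -Z j i (τ i))).card : ℝ) := by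
        exact_mod_cast Finset.card_biUnion_le
    _ ≤ ∑ _j : X, 2 * ((Fintype.card G : ℝ) ^ n * Real.exp (-(n * a ^ 2 / 4))) := by
        refine Finset.sum_le_sum fun j _ => ?_
        have h1 := card_filter_le_exp (Z j) (hZ1 j) (hZ0 j) ha0.le ha1
        have h2 := card_filter_le_exp (fun i g => -Z j i g) (fun i g => by
          rw [abs_neg]; exact hZ1 j i g) (fun i => by rw [Finset.sum_neg_distrib, hZ0, neg_zero])
          ha0.le ha1
        have h3 : (((Finset.univ.filter fun τ : Fin n → G => n * a ≤ ∑ i, Z j i (τ i)) ∪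
          (Finset.univ.filter fun τ : Fin n → G => n * a ≤ ∑ i, -Z j i (τ i))).card : ℝ) ≤
          ((Finset.univ.filter fun τ : Fin n → G => n * a ≤ ∑ i, Z j i (τ i)).card : ℝ) +
          ((Finset.univ.filter fun τ : Fin n → G => n * a ≤ ∑ i, -Z j i (τ i)).card : ℝ) := by
          exact_mod_cast Finset.card_union_le _ _
        linarith
    _ = _ := by
        rw [Finset.sum_const, Finset.card_univ, nsmul_eq_mul]
        ring

end Concentration

/-! ### Rounding a point of the polytope to `n` feasible sets -/

section Rounding

/-- A point of the polytope is, up to `O(1/n)`, the average of `n` feasible indicator vectors. -/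
theorem exists_rounding {X : Type*} [Fintype X] [DecidableEq X] {F : Set (Finset X)} {x : X → ℝ}
    (hx : x ∈ feasiblePolytope F) :
    ∃ C : ℝ, ∀ n : ℕ, ∃ T : ℕ → Finset X, (∀ i, T i ∈ F) ∧
      ∀ j, |∑ i ∈ Finset.range n, indVec (T i) j - n * x j| ≤ C := by
  -- The points with bounded discrepancy contain the vertices and form a convex set; `C` may depend
  -- on the point but not on `n`.
  have hsub : feasiblePolytope F ⊆ {x : X → ℝ | ∃ C : ℝ, ∀ n : ℕ, ∃ T : ℕ → Finset X,
      (∀ i, T i ∈ F) ∧ ∀ j, |∑ i ∈ Finset.range n, indVec (T i) j - n * x j| ≤ C} := by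
    refine convexHull_min ?_ ?_
    · rintro _ ⟨S, hS, rfl⟩
      exact ⟨0, fun n => ⟨fun _ => S, fun _ => hS, fun j => by simp⟩⟩
    · rintro x ⟨C₁, h₁⟩ y ⟨C₂, h₂⟩ a b ha hb hab
      refine ⟨C₁ + C₂ + ∑ k, |x k - y k|, fun n => ?_⟩
      -- The first `n₁` sets come from `x`, the others from `y`; the floor shifts less than one unit
      -- of weight, which costs at most `∑ |x - y|`.
      set n₁ : ℕ := ⌊a * n⌋₊ with hn₁
      have ha1 : a ≤ 1 := by linarith
      have hn : (0 : ℝ) ≤ n := Nat.cast_nonneg n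
      have hfl : (n₁ : ℝ) ≤ a * n := Nat.floor_le (by positivity)
      have hfu : a * n < n₁ + 1 := Nat.lt_floor_add_one _
      have hle : n₁ ≤ n := by
        have : (n₁ : ℝ) ≤ n := hfl.trans (mul_le_of_le_one_left hn ha1)
        exact_mod_cast this
      obtain ⟨n₂, hn₂⟩ := Nat.exists_eq_add_of_le hle
      have hcast : (n : ℝ) = n₁ + n₂ := by exact_mod_cast hn₂
      obtain ⟨T₁, hT₁, hb₁⟩ := h₁ n₁
      obtain ⟨T₂, hT₂, hb₂⟩ := h₂ n₂
      refine ⟨fun i => if i < n₁ then T₁ i else T₂ (i - n₁), fun i => ?_, fun j => ?_⟩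
      · beta_reduce
        split_ifs
        · exact hT₁ i
        · exact hT₂ _
      · have e1 : ∑ i ∈ Finset.range n,
            indVec (if i < n₁ then T₁ i else T₂ (i - n₁)) j =
            ∑ i ∈ Finset.range n₁, indVec (T₁ i) j + ∑ i ∈ Finset.range n₂, indVec (T₂ i) j := by
          rw [hn₂, Finset.sum_range_add]
          congr 1
          · exact Finset.sum_congr rfl fun i hi => by rw [if_pos (Finset.mem_range.1 hi)]
          · exact Finset.sum_congr rfl fun i _ => by simp
        have e2 : ∑ i ∈ Finset.range n,
            indVec (if i < n₁ then T₁ i else T₂ (i - n₁)) j - (n : ℝ) *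
              (a • x + b • y) j =
            (∑ i ∈ Finset.range n₁, indVec (T₁ i) j - n₁ * x j) +
            (∑ i ∈ Finset.range n₂, indVec (T₂ i) j - n₂ * y j) +
            (n₁ - a * (n : ℝ)) * (x j - y j) := by
          rw [e1]
          have hb' : b = 1 - a := by linarith
          simp only [Pi.add_apply, Pi.smul_apply, smul_eq_mul, hb', hcast]
          ring
        rw [e2]
        have e3 : |((n₁ : ℝ) - a * (n : ℝ)) * (x j - y j)| ≤ ∑ k, |x k - y k| := by
          rw [abs_mul]
          refine (mul_le_of_le_one_left (abs_nonneg _) ?_).trans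
            (Finset.single_le_sum (f := fun k => |x k - y k|) (fun k _ => abs_nonneg _)
              (Finset.mem_univ j))
          rw [abs_le]
          constructor <;> linarith
        exact (abs_add_le _ _).trans
          (add_le_add ((abs_add_le _ _).trans (add_le_add (hb₁ j) (hb₂ j))) e3)
  exact hsub hx

end Rounding

/-! ### Indistinguishable oracles -/

section Indistinguishability

open Classical in
/-- A decision tree distinguishes the oracle `g` from few of the oracles `h τ` with few queries,
if for each query few of the oracles `h τ` differ from `g`. -/
theorem card_run_ne_le {U Out T : Type*} [Fintype T] (g : Finset U → ℝ) (h : T → Finset U → ℝ)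
    {β : ℝ} (hβ : ∀ S, ((Finset.univ.filter fun τ => h τ S ≠ g S).card : ℝ) ≤ β)
    (t : QueryTree U Out) :
    ((Finset.univ.filter fun τ => t.run (h τ) ≠ t.run g).card : ℝ) ≤ β * t.numQueries g := by
  induction t with
  | output o => simp [QueryTree.run, QueryTree.numQueries]
  | query S next ih =>
    -- As long as answers agree, both runs stay in the same subtree. The union bound is therefore
    -- over the path of `g` alone, and adaptivity costs nothing.
    have hsub : (Finset.univ.filter fun τ =>
        (QueryTree.query S next).run (h τ) ≠ (QueryTree.query S next).run g) ⊆
        (Finset.univ.filter fun τ => h τ S ≠ g S) ∪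
        (Finset.univ.filter fun τ => (next (g S)).run (h τ) ≠ (next (g S)).run g) := by
      intro τ hτ
      have hτ' : (next (h τ S)).run (h τ) ≠ (next (g S)).run g := (Finset.mem_filter.1 hτ).2
      by_cases hS : h τ S = g S
      · rw [hS] at hτ'
        exact Finset.mem_union_right _ (Finset.mem_filter.2 ⟨Finset.mem_univ τ, hτ'⟩)
      · exact Finset.mem_union_left _ (Finset.mem_filter.2 ⟨Finset.mem_univ τ, hS⟩)
    have h1 : ((Finset.univ.filter fun τ =>
        (QueryTree.query S next).run (h τ) ≠ (QueryTree.query S next).run g).card : ℝ) ≤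
        ((Finset.univ.filter fun τ => h τ S ≠ g S).card : ℝ) +
        ((Finset.univ.filter fun τ =>
          (next (g S)).run (h τ) ≠ (next (g S)).run g).card : ℝ) := by
      exact_mod_cast (Finset.card_le_card hsub).trans (Finset.card_union_le _ _)
    have h2 := hβ S
    have h3 := ih (g S)
    simp only [QueryTree.numQueries]
    push_cast
    linarith

open Classical in
/-- For few `τ` the multilinear extension of `h τ` exceeds that of `g` significantly at a given
point, if for each set few of the functions `h τ` differ from `g`. -/
theorem card_multilinearExt_lt_le {U T : Type*} [Fintype U] [DecidableEq U] [Fintype T]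
    (g : Finset U → ℝ) (h : T → Finset U → ℝ) {β M e : ℝ}
    (hβ : ∀ S, ((Finset.univ.filter fun τ => h τ S ≠ g S).card : ℝ) ≤ β) (hM : 0 ≤ M)
    (hg : ∀ S, 0 ≤ g S) (hh : ∀ τ S, h τ S ≤ M) {z : U → ℝ} (h0 : 0 ≤ z) (h1 : z ≤ 1)
    (he : 0 < e) :
    ((Finset.univ.filter fun τ =>
      multilinearExt g z + e < multilinearExt (h τ) z).card : ℝ) ≤ M * β / e := by
  rw [le_div_iff₀ he]
  have hdiff : ∀ τ, multilinearExt (h τ) z - multilinearExt g z ≤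
      multilinearExt (fun S => M * if h τ S ≠ g S then 1 else 0) z := by
    intro τ
    rw [← multilinearExt_sub]
    refine multilinearExt_mono h0 h1 fun S => ?_
    split_ifs with hS
    · linarith [hg S, hh τ S]
    · rw [not_not] at hS
      simp [hS]
  -- Markov's inequality over `τ`, after exchanging the sum over `τ` with the expectation over the
  -- random set `S` drawn from `z`.
  calc ((Finset.univ.filter fun τ =>
        multilinearExt g z + e < multilinearExt (h τ) z).card : ℝ) * e
      = ∑ τ, if multilinearExt g z + e < multilinearExt (h τ) z then e else 0 := by
        rw [← Finset.sum_filter, Finset.sum_const, nsmul_eq_mul]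
    _ ≤ ∑ τ, multilinearExt (fun S => M * if h τ S ≠ g S then 1 else 0) z := by
        refine Finset.sum_le_sum fun τ _ => ?_
        split_ifs with hτ
        · linarith [hdiff τ]
        · refine multilinearExt_nonneg h0 h1 fun S => ?_
          split_ifs <;> simp [hM]
    _ = multilinearExt (fun S => M * ((Finset.univ.filter fun τ => h τ S ≠ g S).card : ℝ)) z := by
        simp only [multilinearExt_eq, Finset.card_filter]
        rw [Finset.sum_comm]
        refine Finset.sum_congr rfl fun S _ => ?_
        push_cast
        rw [← Finset.sum_mul, Finset.mul_sum]
    _ ≤ multilinearExt (fun _ => M * β) z :=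
        multilinearExt_mono h0 h1 fun S => mul_le_mul_of_nonneg_left (hβ S) hM
    _ = M * β := multilinearExt_const _ _

/-- Double counting: turns a bound for each seed on the number of bad `τ` into a bound on the total
probability of the bad events. -/
theorem sum_measure_le_lintegral {Ω T : Type*} [MeasurableSpace Ω] [Fintype T] (μ : Measure Ω)
    {D : T → Set Ω} [∀ ω, DecidablePred fun τ => ω ∈ D τ] (hD : ∀ τ, MeasurableSet (D τ)) {h : Ω → ENNReal}
    (hh : ∀ ω, ((Finset.univ.filter fun τ => ω ∈ D τ).card : ENNReal) ≤ h ω) :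
    ∑ τ, μ (D τ) ≤ ∫⁻ ω, h ω ∂μ := by
  have h1 : ∀ τ, μ (D τ) = ∫⁻ ω, (D τ).indicator 1 ω ∂μ := fun τ =>
    (lintegral_indicator_one (hD τ)).symm
  simp only [h1]
  rw [← lintegral_finsetSum _ fun τ _ => measurable_one.indicator (hD τ)]
  refine lintegral_mono fun ω => le_trans (le_of_eq ?_) (hh ω)
  rw [Finset.card_filter]
  push_cast
  exact Finset.sum_congr rfl fun τ _ => by simp [Set.indicator_apply]

end Indistinguishability

/-! ### Optimal values of the relaxation -/

section Relaxation

variable {U : Type*} [Fintype U] [DecidableEq U]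

omit [DecidableEq U] in
theorem exists_abs_le (f : Finset U → ℝ) : ∃ M : ℝ, 0 ≤ M ∧ ∀ S, |f S| ≤ M :=
  ⟨∑ S, |f S|, Finset.sum_nonneg fun _ _ => abs_nonneg _,
    fun S => Finset.single_le_sum (fun S _ => abs_nonneg (f S)) (Finset.mem_univ S)⟩

theorem bddAbove_multilinearExt (f : Finset U → ℝ) (F : Set (Finset U)) :
    BddAbove (multilinearExt f '' feasiblePolytope F) := by
  obtain ⟨M, -, hM⟩ := exists_abs_le f
  refine ⟨M, ?_⟩
  rintro _ ⟨x, hx, rfl⟩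
  have h := feasiblePolytope_subset_cube F hx
  exact (abs_le.1 (abs_multilinearExt_le h.1 h.2 hM)).2

theorem multilinearExt_le_relaxOpt (f : Finset U → ℝ) {F : Set (Finset U)} {x : U → ℝ}
    (hx : x ∈ feasiblePolytope F) : multilinearExt f x ≤ relaxOpt f F :=
  le_csSup (bddAbove_multilinearExt f F) ⟨x, hx, rfl⟩

theorem multilinearExt_symmetrize_le_symRelaxOpt (f : Finset U → ℝ) {F : Set (Finset U)}
    (G : Subgroup (Equiv.Perm U)) [Fintype G] {x : U → ℝ} (hx : x ∈ feasiblePolytope F) :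
    multilinearExt f (symmetrize G x) ≤ symRelaxOpt f F G := by
  refine le_csSup ?_ ⟨x, hx, rfl⟩
  obtain ⟨M, -, hM⟩ := exists_abs_le f
  refine ⟨M, ?_⟩
  rintro _ ⟨x, hx, rfl⟩
  have h := feasiblePolytope_subset_cube F hx
  exact (abs_le.1 (abs_multilinearExt_le (symmetrize_nonneg G h.1)
    (symmetrize_le_one G h.2) hM)).2

theorem exists_lt_multilinearExt {f : Finset U → ℝ} {F : Set (Finset U)} {b : ℝ}
    (hpos : 0 < relaxOpt f F) (hb : b < relaxOpt f F) :
    ∃ x ∈ feasiblePolytope F, b < multilinearExt f x := by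
  -- `sSup ∅ = 0` in `ℝ`, so a positive optimum excludes an empty family.
  have hne : (multilinearExt f '' feasiblePolytope F).Nonempty := by
    by_contra h
    rw [Set.not_nonempty_iff_eq_empty] at h
    rw [relaxOpt, h, Real.sSup_empty] at hpos
    exact lt_irrefl _ hpos
  obtain ⟨_, ⟨x, hx, rfl⟩, hlt⟩ := exists_lt_of_lt_csSup hne hb
  exact ⟨x, hx, hlt⟩

theorem symmetrize_pos (G : Subgroup (Equiv.Perm U)) [Fintype G] {x : U → ℝ} (hx : 0 ≤ x) {j : U}
    (hj : 0 < x j) : 0 < symmetrize G x j := by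
  rw [symmetrize_apply]
  exact div_pos (Finset.sum_pos' (fun σ _ => hx _) ⟨1, Finset.mem_univ _, hj⟩) (card_group_pos G)

/-- Symmetrization cannot annihilate the value: a set in the support of `x` is in the support of
its symmetrization. -/
theorem symRelaxOpt_pos {f : Finset U → ℝ} {F : Set (Finset U)} (G : Subgroup (Equiv.Perm U))
    [Fintype G] (hf : ∀ S, 0 ≤ f S) (hpos : 0 < relaxOpt f F) : 0 < symRelaxOpt f F G := by
  obtain ⟨x, hx, hlt⟩ := exists_lt_multilinearExt hpos hpos
  refine lt_of_lt_of_le ?_ (multilinearExt_symmetrize_le_symRelaxOpt f G hx)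
  have hc := feasiblePolytope_subset_cube F hx
  rw [multilinearExt_eq] at hlt ⊢
  obtain ⟨S, -, hS⟩ := Finset.exists_ne_zero_of_sum_ne_zero hlt.ne'
  have hfS : 0 < f S := lt_of_le_of_ne (hf S) (left_ne_zero_of_mul hS).symm
  have hw := Finset.prod_ne_zero_iff.1 (right_ne_zero_of_mul hS)
  have hsub : symmetrize G (1 - x) = 1 - symmetrize G x := by
    have h := map_sub (symmetrizeLinear G) 1 x
    have h1 : symmetrizeLinear G 1 = 1 := symmetrize_one G
    rwa [h1] at h
  refine Finset.sum_pos' (fun T _ => mul_nonneg (hf T) (weight_nonneg (symmetrize_nonneg G hc.1)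
    (symmetrize_le_one G hc.2) T)) ⟨S, Finset.mem_univ S, mul_pos hfS ?_⟩
  refine Finset.prod_pos fun i _ => ?_
  have hi := hw i (Finset.mem_univ i)
  by_cases h : i ∈ S
  · rw [if_pos h] at hi ⊢
    exact symmetrize_pos G hc.1 (lt_of_le_of_ne (hc.1 i) hi.symm)
  · rw [if_neg h] at hi ⊢
    have h0 : 0 ≤ 1 - x := sub_nonneg.2 hc.2
    have h1 : 0 < (1 - x) i := lt_of_le_of_ne (h0 i) hi.symm
    have h2 := symmetrize_pos G h0 h1
    rwa [hsub] at h2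

end Relaxation

/-! ### From guarantees in expectation to guarantees with positive probability -/

section Approximation

variable {U Ω : Type*} [Fintype U] [DecidableEq U] [MeasurableSpace Ω]

theorem ApproxWithProb.of_le {A : RandomizedAlg U Ω} {μ : Measure Ω} [IsProbabilityMeasure μ]
    {α α' p p' : ℝ} {f : Finset U → ℝ} {F : Set (Finset U)} (h : A.ApproxWithProb μ α p f F)
    (hα : α' ≤ α) (hp : p' ≤ p) (hopt : 0 ≤ relaxOpt f F) : A.ApproxWithProb μ α' p' f F :=
  hp.trans (h.trans (measureReal_mono fun _ hω =>
    ⟨hω.1, (mul_le_mul_of_nonneg_right hα hopt).trans hω.2⟩))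

theorem measurableSet_feasiblePolytope (F : Set (Finset U)) :
    MeasurableSet (feasiblePolytope F) :=
  ((F.toFinite.image indVec).isClosed_convexHull ℝ).measurableSet

/-- An approximation in expectation is an approximation with positive probability. -/
theorem ApproxInExpectation.approxWithProb {A : RandomizedAlg U Ω} {μ : Measure Ω}
    [IsProbabilityMeasure μ] {α α' : ℝ} {f : Finset U → ℝ} {F : Set (Finset U)}
    (h : A.ApproxInExpectation μ α f F) (hα' : 0 ≤ α') (hf : ∀ S, 0 ≤ f S)
    (hopt : 0 < relaxOpt f F) : A.ApproxWithProb μ α' (α - α') f F := by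
  set E : Set Ω := {ω | (A.tree ω).run f ∈ feasiblePolytope F ∧
    α' * relaxOpt f F ≤ multilinearExt f ((A.tree ω).run f)} with hE
  have hEm : MeasurableSet E :=
    (A.measurable_run f (measurableSet_feasiblePolytope F)).inter
      (measurableSet_le measurable_const
        ((continuous_multilinearExt f).measurable.comp (A.measurable_run f)))
  have hint : Integrable (fun ω => α' * relaxOpt f F + E.indicator (fun _ => relaxOpt f F) ω) μ :=
    (integrable_const _).add ((integrable_const _).indicator hEm)
  -- Reverse Markov: a feasible output is worth less than `α' * opt` outside `E`, and at most `opt`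
  -- on `E`.
  have hle : ∫ ω, multilinearExt f ((A.tree ω).run f) ∂μ ≤
      ∫ ω, (α' * relaxOpt f F + E.indicator (fun _ => relaxOpt f F) ω) ∂μ := by
    refine integral_mono_of_nonneg ?_ hint ?_
    · filter_upwards [h.1] with ω hω
      have hc := feasiblePolytope_subset_cube F hω
      exact multilinearExt_nonneg hc.1 hc.2 hf
    · filter_upwards [h.1] with ω hω
      by_cases hωE : ω ∈ E
      · rw [Set.indicator_of_mem hωE]
        have := multilinearExt_le_relaxOpt f hω
        nlinarith [mul_nonneg hα' hopt.le]
      · rw [Set.indicator_of_notMem hωE, add_zero]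
        by_contra hcon
        exact hωE ⟨hω, (not_le.1 hcon).le⟩
  rw [integral_add (integrable_const _) ((integrable_const _).indicator hEm),
    integral_indicator_const _ hEm] at hle
  simp only [integral_const, probReal_univ, smul_eq_mul] at hle
  have hfin := h.2.trans hle
  have : (α - α') * relaxOpt f F ≤ μ.real E * relaxOpt f F := by linarith
  exact le_of_mul_le_mul_right this hopt

end Approximation

/-! ### The lower bound on the number of queries -/

section Hardness

variable {X : Type*} [Fintype X] [DecidableEq X]

/-- Algorithms which succeed with constant probability need exponentially many queries. -/
theorem exists_expectedQueries_ge_of_approxWithProb (mono : Prop)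
    (f : Finset X → ℝ) (F : Set (Finset X)) (G : Subgroup (Equiv.Perm X)) [Fintype G]
    (hf : IsObjective mono f) (hsym : StronglySymmetric f F G)
    (hOPT : 0 < relaxOpt f F) (ε : ℝ) (hε : 0 < ε) :
    ∃ c : ℝ, 0 < c ∧ ∀ p : ℝ, 0 < p → ∃ n₀ : ℕ, ∀ n : ℕ, n₀ ≤ n →
      ∀ (Ω : Type*) [MeasurableSpace Ω] (μ : Measure Ω) [IsProbabilityMeasure μ]
        (A : RandomizedAlg (Fin n × X) Ω),
        (∀ g : Finset (Fin n × X) → ℝ, IsObjective mono g → 0 < relaxOpt g (refinement n F) →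
            A.ApproxWithProb μ ((1 + ε) * symmetryGap f F G) p g (refinement n F)) →
        ∃ g : Finset (Fin n × X) → ℝ, IsObjective mono g ∧
          ENNReal.ofReal (Real.exp (c * (Fintype.card (Fin n × X) : ℝ))) ≤
            A.expectedQueries μ g := by
  classical
  set O := relaxOpt f F with hO
  set O' := symRelaxOpt f F G with hO'
  have hO'0 : 0 < O' := symRelaxOpt_pos G hf.nonneg hOPT
  set γ := symmetryGap f F G with hγ
  have hγ0 : 0 < γ := div_pos hO'0 hOPT
  have hγO : γ * O = O' := div_mul_cancel₀ _ hOPT.ne'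
  set m : ℝ := ((Fintype.card X : ℕ) : ℝ) with hm
  have hm0 : 0 ≤ m := Nat.cast_nonneg _
  obtain ⟨M, hM0, hM⟩ := exists_abs_le f
  -- The last condition says `(1 + ε) * γ * (O - 3 * e) > O' + 2 * e`: the required value on `h τ`
  -- exceeds what `g` allows by more than `e`.
  obtain ⟨e, he0, heO, heγ⟩ : ∃ e : ℝ, 0 < e ∧ 3 * e < O ∧
      e * (2 + 3 * ((1 + ε) * γ)) < ε * O' := by
    set b : ℝ := 2 + 3 * ((1 + ε) * γ) with hb
    have hb0 : 0 < b := by positivity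
    refine ⟨min (O / 6) (ε * O' / (2 * b)), by positivity, ?_, ?_⟩
    · have := min_le_left (O / 6) (ε * O' / (2 * b))
      linarith
    · calc min (O / 6) (ε * O' / (2 * b)) * b ≤ ε * O' / (2 * b) * b :=
            mul_le_mul_of_nonneg_right (min_le_right _ _) hb0.le
        _ = ε * O' / 2 := by field_simp
        _ < ε * O' := half_lt_self (by positivity)
  obtain ⟨δ, Φ, hδ, hΦ, hclose, hflat⟩ := exists_isDRFunction G hf hsym.invariant he0
  set M' : ℝ := M + e with hM'
  have hM'0 : 0 ≤ M' := by positivity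
  have hΦM : ∀ x : X → ℝ, 0 ≤ x → x ≤ 1 → Φ x ≤ M' := by
    intro x h0 h1
    have h2 := (abs_le.1 (hclose x h0 h1)).2
    have h3 := (abs_le.1 (abs_multilinearExt_le h0 h1 hM)).2
    linarith
  obtain ⟨x, hx, hxO⟩ := exists_lt_multilinearExt (b := O - e) hOPT (by linarith)
  have hxc := feasiblePolytope_subset_cube F hx
  obtain ⟨C, hC⟩ := exists_rounding hx
  obtain ⟨a, ha0, ha1, haδ⟩ : ∃ a : ℝ, 0 < a ∧ a ≤ 1 ∧ m * a ^ 2 ≤ δ := by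
    refine ⟨min 1 (δ / (m + 1)), by positivity, min_le_left _ _, ?_⟩
    set t := min 1 (δ / (m + 1)) with ht
    have ht0 : 0 < t := by positivity
    have h1 : t ≤ 1 := min_le_left _ _
    have h2 : t * (m + 1) ≤ δ := (le_div_iff₀ (by positivity)).1 (min_le_right _ _)
    have h3 : t ^ 2 ≤ t := by nlinarith
    nlinarith
  -- Then `exp (c * n * m) ≤ exp (n * a² / 8)`, which uses half of the concentration exponent `a² /
  -- 4`; the other half brings the failure probability below `p` for large `n`. Dividing by `m + 1`
  -- covers empty `X`.
  refine ⟨a ^ 2 / (8 * (m + 1)), by positivity, fun p hp => ?_⟩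
  have htend : Filter.Tendsto (fun n : ℕ => 2 * m * (1 + M' / e) * Real.exp (-(n * (a ^ 2 / 8))))
      Filter.atTop (nhds 0) := by
    have h1 : Filter.Tendsto (fun n : ℕ => (n : ℝ) * (a ^ 2 / 8)) Filter.atTop Filter.atTop :=
      tendsto_natCast_atTop_atTop.atTop_mul_const (by positivity)
    have h2 := (Real.tendsto_exp_neg_atTop_nhds_zero.comp h1).const_mul (2 * m * (1 + M' / e))
    simpa using h2
  have htend' : Filter.Tendsto (fun n : ℕ => 2 * M * (m * (C / n))) Filter.atTop (nhds 0) := by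
    have h2 := ((tendsto_const_div_atTop_nhds_zero_nat C).const_mul m).const_mul (2 * M)
    simpa using h2
  obtain ⟨n₀, hn₀⟩ := Filter.eventually_atTop.1 (((htend.eventually (gt_mem_nhds hp)).and
    (htend'.eventually (gt_mem_nhds he0))).and (Filter.eventually_gt_atTop 0))
  refine ⟨n₀, fun n hn Ω _ μ _ A hA => ?_⟩
  obtain ⟨⟨hnp, hnC⟩, hnpos⟩ := hn₀ n hn
  have hnpos' : (0 : ℝ) < n := Nat.cast_pos.2 hnpos
  by_contra! hcon
  set h : (Fin n → G) → Finset (Fin n × X) → ℝ :=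
    fun τ S => Φ (clusterMap (fun i => (τ i : Equiv.Perm X)) (indVec S)) with hh
  set L : (Fin n × X → ℝ) →ₗ[ℝ] (X → ℝ) :=
    symmetrizeLinear G ∘ₗ clusterMap (fun _ : Fin n => (1 : Equiv.Perm X)) with hL
  have hLs : IsSubstochastic L :=
    (isSubstochastic_symmetrizeLinear G).comp (isSubstochastic_clusterMap _)
  set g : Finset (Fin n × X) → ℝ := fun S => Φ (L (indVec S)) with hg
  have hgobj : IsObjective mono g := hΦ.isObjective hLs
  have hhobj : ∀ τ, IsObjective mono (h τ) := fun τ =>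
    hΦ.isObjective (isSubstochastic_clusterMap _)
  have hhM : ∀ τ S, h τ S ≤ M' := fun τ S =>
    hΦM _ ((isSubstochastic_clusterMap _).nonneg _ (indVec_nonneg S))
      ((isSubstochastic_clusterMap _).le_one (indVec_le_one S))
  set N : ℝ := (Fintype.card G : ℝ) ^ n with hN
  have hN0 : 0 < N := pow_pos (card_group_pos G) n
  set β : ℝ := 2 * m * (N * Real.exp (-(n * a ^ 2 / 4))) with hβdef
  have hβ0 : 0 ≤ β := by positivity
  have hβ : ∀ S, ((Finset.univ.filter fun τ => h τ S ≠ g S).card : ℝ) ≤ β := by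
    intro S
    refine le_trans ?_ (card_asymmetry_gt_le G hnpos ha0 ha1 haδ S)
    refine Nat.cast_le.2 (Finset.card_le_card fun τ hτ => ?_)
    rw [Finset.mem_filter] at hτ ⊢
    refine ⟨Finset.mem_univ τ, ?_⟩
    by_contra hle
    refine hτ.2 ?_
    have h1 := hflat _ (not_lt.1 hle)
    rw [symmetrize_clusterMap] at h1
    exact h1
  -- the value of a symmetric point
  have hgle : ∀ z ∈ feasiblePolytope (refinement n F), multilinearExt g z ≤ O' + e := by
    intro z hz
    have hzc := feasiblePolytope_subset_cube _ hz
    have hy := clusterMap_mem_of_mem_refinement hz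
    have hyc := feasiblePolytope_subset_cube _ hy
    have h1 : multilinearExt g z ≤ Φ (symmetrize G (clusterMap (fun _ => 1) z)) :=
      hΦ.multilinearExt_le hLs hzc.1 hzc.2
    have h2 := (abs_le.1 (hclose _ (symmetrize_nonneg G hyc.1) (symmetrize_le_one G hyc.2))).2
    have h3 := multilinearExt_symmetrize_le_symRelaxOpt f G hy
    linarith
  -- the value of an asymmetric point
  have hopt : ∀ τ, O - 3 * e ≤ relaxOpt (h τ) (refinement n F) := by
    intro τ
    obtain ⟨T, hTF, hT⟩ := hC n
    set S := bundle G τ fun i : Fin n => T i with hS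
    have hSF : S ∈ refinement n F := bundle_mem_refinement G hsym hnpos τ fun i => hTF i
    have h1 : h τ S ≤ relaxOpt (h τ) (refinement n F) := by
      rw [← multilinearExt_indVec (h τ) S]
      exact multilinearExt_le_relaxOpt _ (subset_convexHull ℝ _ ⟨S, hSF, rfl⟩)
    refine le_trans ?_ h1
    set y := clusterMap (fun i => (τ i : Equiv.Perm X)) (indVec S) with hy
    have hy0 : 0 ≤ y := (isSubstochastic_clusterMap _).nonneg _ (indVec_nonneg S)
    have hy1 : y ≤ 1 := (isSubstochastic_clusterMap _).le_one (indVec_le_one S)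
    have h2 := (abs_le.1 (hclose y hy0 hy1)).1
    have h3 := (abs_le.1 (abs_multilinearExt_sub_le hM hxc.1 hxc.2 hy0 hy1)).1
    have h4 : ∑ j, |y j - x j| ≤ m * (C / n) := by
      have h5 : ∀ j ∈ (Finset.univ : Finset X), |y j - x j| ≤ C / n := by
        intro j _
        have e1 : y j - x j = (∑ i ∈ Finset.range n, indVec (T i) j - n * x j) / n := by
          rw [hy, hS, clusterMap_bundle, Finset.sum_range, sub_div, mul_div_cancel_left₀ _ hnpos'.ne']
        rw [e1, abs_div, abs_of_pos hnpos']
        exact div_le_div_of_nonneg_right (hT j) hnpos'.le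
      simpa using Finset.sum_le_sum h5
    have h6 : 2 * M * ∑ j, |y j - x j| ≤ 2 * M * (m * (C / n)) :=
      mul_le_mul_of_nonneg_left h4 (by positivity)
    -- One `e` is lost in the choice of `x`, one in rounding, one in passing from `F` to `Φ`.
    change O - 3 * e ≤ Φ y
    linarith
  -- the events that the two oracles are distinguished
  set D : (Fin n → G) → Set Ω := fun τ => {ω | (A.tree ω).run (h τ) ≠ (A.tree ω).run g} with hD
  -- The output can also succeed on `h τ` by luck, without distinguishing the oracles. The cube
  -- condition is needed because outputs on `g` are arbitrary vectors.
  set B : (Fin n → G) → Set Ω := fun τ => {ω | (A.tree ω).run g ∈ Set.Icc 0 1 ∧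
    multilinearExt g ((A.tree ω).run g) + e < multilinearExt (h τ) ((A.tree ω).run g)} with hB
  have hDm : ∀ τ, MeasurableSet (D τ) := fun τ =>
    (measurableSet_eq_fun (A.measurable_run _) (A.measurable_run _)).compl
  have hBm : ∀ τ, MeasurableSet (B τ) := fun τ =>
    (A.measurable_run g isClosed_Icc.measurableSet).inter
      (measurableSet_lt
        (((continuous_multilinearExt g).measurable.comp (A.measurable_run g)).add_const e)
        ((continuous_multilinearExt (h τ)).measurable.comp (A.measurable_run g)))
  -- Success on `h τ` with the same run as on `g` gives a feasible point with `g`-value at most `O'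
  -- + e` and `h τ`-value above `O' + 2 * e`, hence an event in `B τ`.
  have hcover : ∀ τ, ENNReal.ofReal p ≤ μ (D τ) + μ (B τ) := by
    intro τ
    have h1 := hA (h τ) (hhobj τ) (lt_of_lt_of_le (by linarith) (hopt τ))
    refine le_trans ?_ (measure_union_le _ _)
    refine (ENNReal.ofReal_le_iff_le_toReal (measure_ne_top _ _)).2 (le_trans h1 ?_)
    refine measureReal_mono fun ω hω => ?_
    obtain ⟨hω1, hω2⟩ := hω
    by_cases hωD : (A.tree ω).run (h τ) = (A.tree ω).run g
    · right
      rw [hωD] at hω1 hω2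
      refine ⟨feasiblePolytope_subset_cube _ hω1,
        lt_of_le_of_lt (b := (O' + e) + e) ?_ (lt_of_lt_of_le ?_ hω2)⟩
      · linarith [hgle _ hω1]
      · have h2 : (1 + ε) * γ * (O - 3 * e) ≤ (1 + ε) * γ * relaxOpt (h τ) (refinement n F) :=
          mul_le_mul_of_nonneg_left (hopt τ) (by positivity)
        refine lt_of_lt_of_le ?_ h2
        have h3 : (1 + ε) * γ * (O - 3 * e) = (1 + ε) * O' - e * (3 * ((1 + ε) * γ)) := by
          rw [← hγO]
          ring
        rw [h3]
        linarith
    · exact Or.inl hωD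
  have hsumD : ∑ τ, μ (D τ) ≤ ENNReal.ofReal (β * Real.exp (n * a ^ 2 / 8)) := by
    have h1 : ∑ τ, μ (D τ) ≤ ∫⁻ ω, ENNReal.ofReal β * ((A.tree ω).numQueries g : ENNReal) ∂μ := by
      refine sum_measure_le_lintegral μ hDm fun ω => ?_
      rw [← ENNReal.ofReal_natCast, ← ENNReal.ofReal_natCast, ← ENNReal.ofReal_mul hβ0]
      refine ENNReal.ofReal_le_ofReal (le_trans (le_of_eq ?_) (card_run_ne_le g h hβ (A.tree ω)))
      congr!
    have hmeas : Measurable fun ω => ((A.tree ω).numQueries g : ENNReal) :=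
      (measurable_of_countable fun k : ℕ => (k : ENNReal)).comp (A.measurable_numQueries g)
    rw [lintegral_const_mul _ hmeas] at h1
    refine h1.trans ?_
    rw [ENNReal.ofReal_mul hβ0]
    refine mul_le_mul_right ((hcon g hgobj).le.trans (ENNReal.ofReal_le_ofReal ?_)) _
    rw [Real.exp_le_exp, Fintype.card_prod, Fintype.card_fin]
    push_cast
    rw [div_mul_eq_mul_div, div_le_div_iff₀ (by positivity) (by norm_num)]
    nlinarith [mul_pos hnpos' (pow_pos ha0 2)]
  have hsumB : ∑ τ, μ (B τ) ≤ ENNReal.ofReal (M' * β / e) := by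
    have h1 : ∑ τ, μ (B τ) ≤ ∫⁻ _, ENNReal.ofReal (M' * β / e) ∂μ := by
      refine sum_measure_le_lintegral μ hBm fun ω => ?_
      rw [← ENNReal.ofReal_natCast]
      refine ENNReal.ofReal_le_ofReal ?_
      by_cases hω : (A.tree ω).run g ∈ Set.Icc 0 1
      · refine le_trans ?_ (card_multilinearExt_lt_le g h hβ hM'0 hgobj.nonneg hhM hω.1 hω.2 he0)
        exact Nat.cast_le.2 (Finset.card_le_card fun τ hτ =>
          Finset.mem_filter.2 ⟨Finset.mem_univ τ, (Finset.mem_filter.1 hτ).2.2⟩)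
      · refine le_trans (le_of_eq ?_) (show 0 ≤ M' * β / e by positivity)
        exact Nat.cast_eq_zero.2 (Finset.card_eq_zero.2
          (Finset.filter_eq_empty_iff.2 fun τ _ hτ => hω hτ.1))
    simpa using h1
  -- Sum over all `N` hidden clusterings; after division by `N` this contradicts the choice of `n₀`.
  have hsum : ENNReal.ofReal (N * p) ≤
      ENNReal.ofReal (β * Real.exp (n * a ^ 2 / 8) + M' * β / e) := by
    rw [ENNReal.ofReal_add (by positivity) (by positivity)]
    refine le_trans ?_ (add_le_add hsumD hsumB)
    rw [← Finset.sum_add_distrib]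
    refine le_trans ?_ (Finset.sum_le_sum fun τ _ => hcover τ)
    rw [Finset.sum_const, Finset.card_univ, Fintype.card_fun, Fintype.card_fin, nsmul_eq_mul,
      ENNReal.ofReal_mul hN0.le, ← ENNReal.ofReal_natCast]
    push_cast
    exact le_rfl
  have hreal := (ENNReal.ofReal_le_ofReal_iff (by positivity)).1 hsum
  set q : ℝ := Real.exp (-(n * (a ^ 2 / 8))) with hq
  have hq0 : 0 < q := Real.exp_pos _
  have hq1 : q ≤ 1 := Real.exp_le_one_iff.2 (by rw [neg_nonpos]; positivity)
  have e1 : Real.exp (-(n * a ^ 2 / 4)) = q * q := by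
    rw [hq, ← Real.exp_add]
    congr 1
    ring
  have e2 : q * Real.exp (n * a ^ 2 / 8) = 1 := by
    rw [hq, ← Real.exp_add, Real.exp_eq_one_iff]
    ring
  have e3 : β * Real.exp (n * a ^ 2 / 8) + M' * β / e ≤ N * (2 * m * (1 + M' / e) * q) := by
    have e4 : β * Real.exp (n * a ^ 2 / 8) = N * (2 * m * q) := by
      rw [hβdef, e1]
      linear_combination 2 * m * N * q * e2
    have e5 : M' * β / e = N * (2 * m * (M' / e) * (q * q)) := by
      rw [hβdef, e1]
      ring
    have e6 : N * (2 * m * (M' / e) * (q * q)) ≤ N * (2 * m * (M' / e) * q) := by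
      have : q * q ≤ q := mul_le_of_le_one_left hq0.le hq1
      gcongr
    rw [e4, e5]
    linarith
  have e7 : N * (2 * m * (1 + M' / e) * q) < N * p := mul_lt_mul_of_pos_left hnp hN0
  linarith

end Hardness

theorem theorem1p6 {X : Type*} [Fintype X] [DecidableEq X] (mono : Prop)
    (f : Finset X → ℝ) (F : Set (Finset X)) (G : Subgroup (Equiv.Perm X))
    (hf : IsObjective mono f) (hsym : StronglySymmetric f F G)
    (hOPT : 0 < relaxOpt f F) (ε : ℝ) (hε : 0 < ε) :
    ∃ c : ℝ, 0 < c ∧ ∀ p : ℝ, 0 < p → ∃ n₀ : ℕ, ∀ n : ℕ, n₀ ≤ n →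
      ∀ (Ω : Type*) [MeasurableSpace Ω] (μ : Measure Ω) [IsProbabilityMeasure μ]
        (A : RandomizedAlg (Fin n × X) Ω),
        ((∀ g : Finset (Fin n × X) → ℝ, IsObjective mono g →
            A.ApproxInExpectation μ ((1 + ε) * symmetryGap f F G) g (refinement n F)) ∨
          (∀ g : Finset (Fin n × X) → ℝ, IsObjective mono g →
            A.ApproxWithProb μ ((1 + ε) * symmetryGap f F G) p g (refinement n F))) →
        ∃ g : Finset (Fin n × X) → ℝ, IsObjective mono g ∧
          ENNReal.ofReal (Real.exp (c * (Fintype.card (Fin n × X) : ℝ))) ≤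
            A.expectedQueries μ g := by
  have : Fintype G := Fintype.ofFinite G
  have hγ : 0 < symmetryGap f F G := div_pos (symRelaxOpt_pos G hf.nonneg hOPT) hOPT
  obtain ⟨c, hc, hmain⟩ := exists_expectedQueries_ge_of_approxWithProb mono f F G hf hsym hOPT
    (ε / 2) (by positivity)
  refine ⟨c, hc, fun p hp => ?_⟩
  -- Half of `ε` is given up: a `(1 + ε)γ` guarantee in expectation yields a `(1 + ε/2)γ` guarantee
  -- with probability at least `(ε/2)γ`. The minimum serves both kinds of algorithm, and `c` stays
  -- independent of `p`.
  obtain ⟨n₀, hn₀⟩ := hmain (min p (ε / 2 * symmetryGap f F G)) (by positivity)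
  refine ⟨n₀, fun n hn Ω _ μ _ A hA => hn₀ n hn Ω μ A fun g hg hpos => ?_⟩
  have hle : (1 + ε / 2) * symmetryGap f F G ≤ (1 + ε) * symmetryGap f F G :=
    mul_le_mul_of_nonneg_right (by linarith) hγ.le
  rcases hA with hA | hA
  · refine ApproxWithProb.of_le (ApproxInExpectation.approxWithProb (hA g hg)
      (α' := (1 + ε / 2) * symmetryGap f F G) (by positivity) hg.nonneg hpos) le_rfl
      ((min_le_right _ _).trans (le_of_eq ?_)) hpos.le
    ring
  · exact ApproxWithProb.of_le (hA g hg) hle (min_le_left _ _) hpos.le
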